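/- **Setting.** Let $T\ge 1$, $m\ge 0$, $n\ge m+1$, and let $\epsilon_1,\dots,\epsilon_T$ be independent random vectors on a probability space $(\Omega,\mathcal F,\mathbb P)$, each standard normal in $\mathbb R^n$. Given nonrandom $A_t\in\mathbb R^n$, $\lambda_t\in\mathbb R^n$ and $B_{t,s}\in\mathbb R^{n\times n}$ ($1\le s\le t\le T$) with $\det B_{t,t}\ne 0$ for all $t$, put $$G_t=A_t+\sum_{s=1}^tB_{t,s}\epsilon_s,\qquad D_t=\exp\Big\{\sum_{s=1}^t\big(\lambda_s^{\mathrm T}\epsilon_s-\tfrac12\lambda_s^{\mathrm T}\lambda_s\big)\Big\},$$ let $(\mathcal G_t)_{t=0}^T$ be the filtration generated by $G$ ($\mathcal G_0$ trivial), and let $\mathbb Q$ be the measure with $d\mathbb Q/d\mathbb P=D_T$. Write $\mathbb E_t^{\mathbb Q}$ for conditional expectation given $\mathcal G_t$ and $(x)_+=\max(0,x)$. Let $M$ be a probability distribution on $(0,1)$ which either has a bounded density with respect to Lebesgue measure or has support bounded away from $0$ and $1$. Put $\rho_t(Z)=\int_0^1F_{t,-Z}^{-1}(u)\,dM(u)$,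 where $F_{t,-Z}(x)=\mathbb P(-Z\le x\mid\mathcal G_t)$ and $F^{-1}(u)=\min\{x:F(x)\ge u\}$, and $r_0=\int_0^1\Phi^{-1}(u)\,dM(u)$, where $\Phi$ is the standard normal distribution function. Let $X^o_t=G^{(1)}_t$ be the liability cash flow and $X^{f,k}_t=G^{(k+1)}_t$, $k=1,\dots,m$, the cash flows of the replication instruments. For $v\in\mathbb R^m$ put $X^v=X^o-v^{\mathrm T}X^f$ and define $V^v_T=R^v_T=0$ and, backwards for $t=T-1,\dots,0$, $$R^v_t=\rho_t(-X^v_{t+1}-V^v_{t+1}),\qquad C^v_t=\mathbb E^{\mathbb Q}_t\big[(R^v_t-X^v_{t+1}-V^v_{t+1})_+\big],\qquad V^v_t=R^v_t-C^v_t .$$ The value of the liability when the replicating portfolio is $v$ is $L_0^v=\mathbb E^{\mathbb Q}_0\big[\sum_{t=1}^Tv^{\mathrm T}X^f_t\big]+V^v_0$. Let $S_t=\sum_{u=t}^TB_{u,t}$, let $e_1$ be standard normal, let $\mathcal A=\{g\in\mathbb R^n:g_1=1,\ g_k=0\text{ for }k>m+1\}$, and for $g\in\mathbb R^n$ put $\sigma_t(g)=(g^{\mathrm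 T}S_tS_t^{\mathrm T}g)^{1/2}$ and $$c_t(g)=\mathbb E\Big[\big(\sigma_t(g)(r_0-e_1)-g^{\mathrm T}S_t\lambda_t\big)_+\Big],\qquad K(g)=\sum_{t=1}^T\big(\sigma_t(g)r_0-g^{\mathrm T}S_t\lambda_t-c_t(g)\big).$$ **Theorem.** (0) For every $v\in\mathbb R^m$, the processes $X^v,R^v,V^v$ are adapted (up to null sets) and $\mathbb Q$-integrable and, for $t=0,\dots,T-1$, $$V^v_t=\operatorname*{ess\,inf}_{\tau}\ \mathbb E^{\mathbb Q}_t\Big[\sum_{s=t+1}^{\tau-1}X^v_s+R^v_{\tau-1}\Big],$$ where $\tau$ runs through the stopping times with values in $\{t+1,\dots,T+1\}$. (1) There is an optimal solution to the replication problem $$\inf_{v\in\mathbb R^m}\psi(v),\qquad \psi(v)=\mathbb E^{\mathbb Q}_0\Big[\max_{0\le t\le T-1}C^v_t\Big].$$ If $\widehat v$ is any optimal solution, then $\widehat g:=(1,-\widehat v^{\mathrm T},0,\dots,0)^{\mathrm T}\in\mathcal A$ minimizes $g\mapsto\max_{1\le t\le T}c_t(g)$ over $\mathcal A$, and, almost surely,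 $$L_0^{\widehat v}=\sum_{t=1}^T\mathbb E^{\mathbb Q}_0[X^o_t]+K(\widehat g).$$ Conversely, every minimizer of $g\mapsto\max_{1\le t\le T}c_t(g)$ over $\mathcal A$ is of the form $(1,-\widehat v^{\mathrm T},0,\dots,0)^{\mathrm T}$ with $\widehat v$ an optimal solution. (2) The same assertions hold if $\psi(v)$ is replaced by $\mathbb E^{\mathbb Q}_0\big[\sum_{t=0}^{T-1}C^v_t\big]$ and $\max_{1\le t\le T}c_t(g)$ is replaced by $\sum_{t=1}^Tc_t(g)$. -/

import Mathlib

open MeasureTheory ProbabilityTheory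

/-- The lower quantile function `F⁻¹(u) = min {x | u ≤ F(x)}` of a probability measure on `ℝ`
(the minimum exists for `0 < u < 1`). -/
noncomputable def quantile (μ : Measure ℝ) (u : ℝ) : ℝ :=
  sInf {x : ℝ | u ≤ cdf μ x}

/-- `M` is a probability distribution on the Borel subsets of `(0,1)` which either has a bounded
density with respect to Lebesgue measure, or has support bounded away from `0` and `1`. -/
structure IsMixingDistribution (M : Measure ℝ) : Prop where
  isProbabilityMeasure : IsProbabilityMeasure M
  concentrated : M (Set.Ioo 0 1)ᶜ = 0
  bounded_density_or_support :
    (∃ (f : ℝ → ENNReal) (c : NNReal), Measurable f ∧ (∀ u, f u ≤ c) ∧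
      M = (volume : Measure ℝ).withDensity f) ∨
    (∃ a b : ℝ, 0 < a ∧ b < 1 ∧ M (Set.Icc a b)ᶜ = 0)

/-- The conditional risk measure `ρ(Z) = ∫₀¹ F_{-Z}⁻¹(u) dM(u)`, where `F_{-Z}` is the (regular)
conditional distribution function of `-Z` given the sub-σ-algebra `m`, under `P`. -/
noncomputable def condRiskMeasure {Ω : Type*} [MeasurableSpace Ω] (P : Measure Ω)
    [IsProbabilityMeasure P] (m : MeasurableSpace Ω) (M : Measure ℝ) (Z : Ω → ℝ) : Ω → ℝ :=
  fun ω ↦ ∫ u, quantile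
    ((condDistrib (fun ω' ↦ - Z ω') (id : Ω → Ω) P : @Kernel Ω ℝ m _) ω) u ∂M

/-- `V` is the essential infimum, with respect to `μ`, of the family `S` of random variables. -/
def IsEssInfOf {Ω : Type*} [MeasurableSpace Ω] (μ : Measure Ω) (S : Set (Ω → ℝ))
    (V : Ω → ℝ) : Prop :=
  AEMeasurable V μ ∧ (∀ Y ∈ S, V ≤ᵐ[μ] Y) ∧
    ∀ W : Ω → ℝ, AEMeasurable W μ → (∀ Y ∈ S, W ≤ᵐ[μ] Y) → W ≤ᵐ[μ] V

/-- The data of an `n`-dimensional Gaussian model with time periods `1, …, T`: independent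
standard normal vectors `ε_t`, coefficients `A_t`, `B_{t,s}` (only `s ≤ t` is used) with
`det B_{t,t} ≠ 0`, and Girsanov vectors `λ_t`. The index `i : Fin T` stands for the time `i + 1`. -/
structure GaussianModel {Ω : Type*} [MeasurableSpace Ω] (P : Measure Ω) (T n : ℕ) where
  ε : Fin T → Ω → Fin n → ℝ
  A : Fin T → Fin n → ℝ
  B : Fin T → Fin T → Matrix (Fin n) (Fin n) ℝ
  lam : Fin T → Fin n → ℝ
  measurable_ε : ∀ i, Measurable (ε i)
  law_ε : ∀ i, P.map (ε i) = Measure.pi (fun _ : Fin n ↦ gaussianReal 0 1)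
  indep_ε : iIndepFun ε P
  det_B_ne_zero : ∀ i, (B i i).det ≠ 0

namespace GaussianModel

variable {Ω : Type*} [mΩ : MeasurableSpace Ω] {P : Measure Ω} {T n : ℕ}

/-- `G_t = A_t + ∑_{s ≤ t} B_{t,s} ε_s`. -/
def G (𝓜 : GaussianModel P T n) (i : Fin T) (ω : Ω) : Fin n → ℝ :=
  𝓜.A i + ∑ j ∈ Finset.Iic i, (𝓜.B i j).mulVec (𝓜.ε j ω)

theorem measurable_G (𝓜 : GaussianModel P T n) (i : Fin T) : Measurable (𝓜.G i) := by
  have h := 𝓜.measurable_ε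
  refine measurable_pi_lambda _ fun k ↦ ?_
  simp only [G, Pi.add_apply, Finset.sum_apply, Matrix.mulVec, dotProduct]
  fun_prop

/-- The filtration generated by `G_1, …, G_T`: the σ-algebra at time `t` is generated by the `G_s`
with `1 ≤ s ≤ t`; it is trivial at `t = 0` and constant for `t ≥ T`. -/
def filtration (𝓜 : GaussianModel P T n) : Filtration ℕ mΩ where
  seq t := ⨆ (i : Fin T) (_ : (i : ℕ) < t), MeasurableSpace.comap (𝓜.G i) inferInstance
  mono' := fun _ _ hst ↦ iSup_mono fun _ ↦ iSup_mono' fun hi ↦ ⟨hi.trans_le hst, le_rfl⟩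
  le' := fun _ ↦ iSup_le fun i ↦ iSup_le fun _ ↦ (𝓜.measurable_G i).comap_le

/-- `D_t = exp (∑_{s ≤ t} (λ_sᵀ ε_s - λ_sᵀ λ_s / 2))`. -/
noncomputable def D (𝓜 : GaussianModel P T n) (t : ℕ) (ω : Ω) : ℝ :=
  Real.exp (∑ i ∈ Finset.univ.filter (fun i : Fin T ↦ (i : ℕ) < t),
    (𝓜.lam i ⬝ᵥ 𝓜.ε i ω - (1 / 2) * (𝓜.lam i ⬝ᵥ 𝓜.lam i)))

/-- The pricing measure `Q`, with density `D_T` with respect to `P`. -/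
noncomputable def Q (𝓜 : GaussianModel P T n) : Measure Ω :=
  P.withDensity fun ω ↦ ENNReal.ofReal (𝓜.D T ω)

section Valuation

variable [IsProbabilityMeasure P] (𝓜 : GaussianModel P T n) (M : Measure ℝ)

/-- The one-period capital requirement `ρ_t`. -/
noncomputable def rho (t : ℕ) (Z : Ω → ℝ) : Ω → ℝ :=
  condRiskMeasure P (𝓜.filtration t) M Z

/-- `φ_t(Y) = ρ_t(-Y) - E_t^Q[(ρ_t(-Y) - Y)_+]`. -/
noncomputable def phi (t : ℕ) (Y : Ω → ℝ) : Ω → ℝ :=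
  𝓜.rho M t (-Y) - 𝓜.Q[fun ω ↦ max 0 (𝓜.rho M t (-Y) ω - Y ω) | 𝓜.filtration t]

/-- The residual liability values of the residual cash flow `X`, by the backward recursion
`V_T = 0`, `V_t = φ_t(X_{t+1} + V_{t+1})`. Here `X i` is the cash flow at time `i + 1`. -/
noncomputable def V (X : Fin T → Ω → ℝ) (t : ℕ) : Ω → ℝ :=
  if h : t < T then 𝓜.phi M t (X ⟨t, h⟩ + V X (t + 1)) else 0
termination_by T - t

/-- The capital requirements `R_T = 0`, `R_t = ρ_t(-X_{t+1} - V_{t+1})`. -/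
noncomputable def R (X : Fin T → Ω → ℝ) (t : ℕ) : Ω → ℝ :=
  if h : t < T then 𝓜.rho M t (- X ⟨t, h⟩ - 𝓜.V M X (t + 1)) else 0

/-- The value of the reference undertaking,
`C_t = E_t^Q[(R_t - X_{t+1} - V_{t+1})_+]`, for `t = 0, …, T - 1`. -/
noncomputable def C (X : Fin T → Ω → ℝ) (t : Fin T) : Ω → ℝ :=
  𝓜.Q[fun ω ↦ max 0 (𝓜.R M X t ω - X t ω - 𝓜.V M X ((t : ℕ) + 1) ω) | 𝓜.filtration t]

/-- The liability value `L_t = E_t^Q[∑_{s > t} X^r_s] + V_t(X^o - X^r)`. -/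
noncomputable def L (Xo Xr : Fin T → Ω → ℝ) (t : ℕ) : Ω → ℝ :=
  𝓜.Q[fun ω ↦ ∑ i ∈ Finset.univ.filter (fun i : Fin T ↦ t ≤ (i : ℕ)), Xr i ω
    | 𝓜.filtration t] + 𝓜.V M (Xo - Xr) t

/-- The family of `E_t^Q[∑_{s=t+1}^{τ-1} X_s + R_{τ-1}]`, where `τ` runs through the stopping times
with values in `{t + 1, …, T + 1}`. -/
def stoppedValues (X : Fin T → Ω → ℝ) (R : ℕ → Ω → ℝ) (t : ℕ) : Set (Ω → ℝ) :=
  {Y | ∃ τ : Ω → ℕ, IsStoppingTime 𝓜.filtration (fun ω ↦ (τ ω : WithTop ℕ)) ∧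
    (∀ ω, t + 1 ≤ τ ω ∧ τ ω ≤ T + 1) ∧
    Y = 𝓜.Q[fun ω ↦
        (∑ i ∈ Finset.univ.filter (fun i : Fin T ↦ t ≤ (i : ℕ) ∧ (i : ℕ) + 1 < τ ω), X i ω)
          + R (τ ω - 1) ω
      | 𝓜.filtration t]}

/-- `V` is the process of residual liability values of the cash flow `X` and of the capital
requirements `R` in the sense of optimal default: all processes are adapted (up to null sets) and
`Q`-integrable, `R_T = V_T = 0`, and
`V_t = essinf_τ E_t^Q[∑_{s=t+1}^{τ-1} X_s + R_{τ-1}]` for `t < T`. -/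
structure IsResidualLiabilityValue (X : Fin T → Ω → ℝ) (R V : ℕ → Ω → ℝ) : Prop where
  cashflow : ∀ i : Fin T, AEStronglyMeasurable[𝓜.filtration ((i : ℕ) + 1)] (X i) 𝓜.Q ∧
    Integrable (X i) 𝓜.Q
  capital : ∀ t < T, AEStronglyMeasurable[𝓜.filtration t] (R t) 𝓜.Q ∧ Integrable (R t) 𝓜.Q
  value : ∀ t < T, AEStronglyMeasurable[𝓜.filtration t] (V t) 𝓜.Q ∧ Integrable (V t) 𝓜.Q
  terminal : R T = 0 ∧ V T = 0
  essInf : ∀ t < T, IsEssInfOf 𝓜.Q (𝓜.stoppedValues X R t) (V t)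

end Valuation

section Replication

variable (𝓜 : GaussianModel P T n) {m : ℕ} (hmn : m + 1 ≤ n)

/-- The liability cash flow `X^o = G^{(1)}`. -/
def Xo (i : Fin T) (ω : Ω) : ℝ := 𝓜.G i ω ⟨0, by omega⟩

/-- The cash flow `vᵀ X^f` of the portfolio `v` in the instruments
`X^{f,1} = G^{(2)}, …, X^{f,m} = G^{(m+1)}`. -/
def Xr (v : Fin m → ℝ) (i : Fin T) (ω : Ω) : ℝ :=
  ∑ k : Fin m, v k * 𝓜.G i ω ⟨(k : ℕ) + 1, by omega⟩

/-- The residual cash flow `X^v = X^o - vᵀ X^f`. -/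
def Xres (v : Fin m → ℝ) : Fin T → Ω → ℝ := 𝓜.Xo hmn - 𝓜.Xr hmn v

variable [IsProbabilityMeasure P] (M : Measure ℝ)

/-- The replication criterion `ψ(v) = E^Q[max_{t < T} C_t^v]`. -/
noncomputable def psiMax (v : Fin m → ℝ) : ℝ :=
  ∫ ω, ⨆ t : Fin T, 𝓜.C M (𝓜.Xres hmn v) t ω ∂𝓜.Q

/-- The replication criterion `E^Q[∑_{t < T} C_t^v]`. -/
noncomputable def psiSum (v : Fin m → ℝ) : ℝ :=
  ∫ ω, ∑ t : Fin T, 𝓜.C M (𝓜.Xres hmn v) t ω ∂𝓜.Q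

/-- The value `L_0` of the liability with replicating portfolio `v`. -/
noncomputable def L0 (v : Fin m → ℝ) : Ω → ℝ := 𝓜.L M (𝓜.Xo hmn) (𝓜.Xr hmn v) 0

end Replication

section Explicit

variable (𝓜 : GaussianModel P T n)

/-- `S_t = ∑_{u ≥ t} B_{u,t}`. -/
def S (i : Fin T) : Matrix (Fin n) (Fin n) ℝ := ∑ u ∈ Finset.Ici i, 𝓜.B u i

/-- `σ_t(g) = (gᵀ S_t S_tᵀ g)^{1/2}`. -/
noncomputable def sigma (g : Fin n → ℝ) (i : Fin T) : ℝ :=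
  Real.sqrt (g ⬝ᵥ (𝓜.S i * (𝓜.S i).transpose).mulVec g)

/-- `E[(σ_t(g) (r₀ - e₁) - gᵀ S_t λ_t)_+]` with `e₁` standard normal. -/
noncomputable def expectedGain (r₀ : ℝ) (g : Fin n → ℝ) (i : Fin T) : ℝ :=
  ∫ x, max 0 (𝓜.sigma g i * (r₀ - x) - g ⬝ᵥ (𝓜.S i).mulVec (𝓜.lam i)) ∂(gaussianReal 0 1)

/-- `K(g) = ∑_t (σ_t(g) r₀ - gᵀ S_t λ_t - E[(σ_t(g) (r₀ - e₁) - gᵀ S_t λ_t)_+])`. -/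
noncomputable def K (r₀ : ℝ) (g : Fin n → ℝ) : ℝ :=
  ∑ i : Fin T, (𝓜.sigma g i * r₀ - g ⬝ᵥ (𝓜.S i).mulVec (𝓜.lam i) - 𝓜.expectedGain r₀ g i)

end Explicit

end GaussianModel

/-- `r₀ = ∫₀¹ Φ⁻¹(u) dM(u)`, with `Φ` the standard normal distribution function. -/
noncomputable def rZero (M : Measure ℝ) : ℝ := ∫ u, quantile (gaussianReal 0 1) u ∂M

/-- `{g ∈ ℝⁿ : g_1 = 1, g_k = 0 for k > m + 1}`; the (one-based) coordinate `g_k` is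
`g ⟨k - 1, _⟩`. -/
def admissibleWeights (n m : ℕ) : Set (Fin n → ℝ) :=
  {g | ∀ k : Fin n, ((k : ℕ) = 0 → g k = 1) ∧ (m < (k : ℕ) → g k = 0)}

/-- The vector `g = (1, -v, 0)`, so that `X^v = gᵀ G`. -/
def residualWeights (n : ℕ) {m : ℕ} (v : Fin m → ℝ) (k : Fin n) : ℝ :=
  if (k : ℕ) = 0 then 1
  else if h : (k : ℕ) - 1 < m then - v ⟨(k : ℕ) - 1, h⟩ else 0

/-!
Along a linear cash flow `gᵀ G` every conditional law that occurs is Gaussian, which makes the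
backward recursion explicit. The innovations `ε_t` generate the same filtration as `G`, because
the matrices `B_{t,t}` are invertible. By induction backwards in time, `V_t` is the part of the
future cash flow that is known at time `t` plus a constant (`GaussianModel.V_ae_eq`), and
`X_{t+1} + V_{t+1}` is known at time `t` up to the independent Gaussian increment
`gᵀ S_{t+1} ε_{t+1}`. The risk of such a variable is its known part plus `σ r₀`
(`condRiskMeasure_ae_eq`); this uses the translation and scaling of quantiles and the
integrability of `Φ⁻¹` with respect to `M`. The density of `Q` is a product of functions of the
individual innovations, so under `Q` the innovations stay independent and only their means move,
to `λ_t` (`GaussianModel.map_ε_Q`). Therefore `C_t` is almost surely the constant `c_{t+1}(g)`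
(`GaussianModel.C_ae_eq_expectedGain`), and summing the constants gives the formula for `L_0`.

The recursion can be written `V_t = E_t^Q[min(R_t, X_{t+1} + V_{t+1})]`. This is the dynamic
programming equation of an optimal stopping problem, which identifies `V_t` with the essential
infimum over stopping times; the infimum is attained by stopping at the first time at which
`R_t ≤ X_{t+1} + V_{t+1}` (`IsSnellRecursion.value_le_condExp_stoppingPayoff`,
`IsSnellRecursion.exists_condExp_stoppingPayoff_eq`).

Since the `C_t` are constant, both replication criteria are finite-dimensional functions of `g`,
and portfolios correspond bijectively to admissible `g`. The functions `c_t` are continuous,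
nonnegative and positively homogeneous, and `c_T` is positive away from `0` because
`S_T = B_{T,T}` is invertible. Both criteria therefore dominate a positive multiple of `‖g‖`, and
a minimizer exists.
-/

/-! ### Independence under a product density -/

section ProductDensity

variable {Ω ι : Type*} [MeasurableSpace Ω] {P : Measure Ω} [Fintype ι] {β : ι → Type*}
  [∀ i, MeasurableSpace (β i)] {X : ∀ i, Ω → β i} {f : ∀ i, β i → ENNReal}

/-- The measure of a cylinder set under a product density factorizes. Coordinates outside `S`
contribute the total mass `1` of their factor. -/
theorem withDensity_prod_iInter_preimage (hX : ∀ i, Measurable (X i)) (h : iIndepFun X P)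
    (hf : ∀ i, Measurable (f i)) (h1 : ∀ i, ∫⁻ ω, f i (X i ω) ∂P = 1) (S : Finset ι)
    {s : ∀ i, Set (β i)} (hs : ∀ i ∈ S, MeasurableSet (s i)) :
    P.withDensity (fun ω ↦ ∏ i, f i (X i ω)) (⋂ i ∈ S, X i ⁻¹' s i) =
      ∏ i ∈ S, ∫⁻ ω in X i ⁻¹' s i, f i (X i ω) ∂P := by
  classical
  set g : ∀ i, β i → ENNReal := fun i ↦ if i ∈ S then (s i).indicator (f i) else f i with hg
  have hgm : ∀ i, Measurable (g i) := by
    intro i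
    simp only [hg]
    split_ifs with hi
    · exact (hf i).indicator (hs i hi)
    · exact hf i
  have hmeas : MeasurableSet (⋂ i ∈ S, X i ⁻¹' s i) :=
    Finset.measurableSet_biInter S fun i hi ↦ hX i (hs i hi)
  have key : ∀ ω, (⋂ i ∈ S, X i ⁻¹' s i).indicator (fun ω ↦ ∏ i, f i (X i ω)) ω =
      ∏ i, g i (X i ω) := by
    intro ω
    by_cases hω : ω ∈ ⋂ i ∈ S, X i ⁻¹' s i
    · rw [Set.indicator_of_mem hω]
      refine Finset.prod_congr rfl fun i _ ↦ ?_
      simp only [hg]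
      split_ifs with hi
      · rw [Set.indicator_of_mem]
        exact Set.mem_iInter₂.1 hω i hi
      · rfl
    · rw [Set.indicator_of_notMem hω]
      simp only [Set.mem_iInter, not_forall] at hω
      obtain ⟨i, hi, hni⟩ := hω
      refine (Finset.prod_eq_zero (Finset.mem_univ i) ?_).symm
      simp only [hg, if_pos hi]
      exact Set.indicator_of_notMem (f := f i) (s := s i) hni
  rw [withDensity_apply _ hmeas, ← lintegral_indicator hmeas]
  simp_rw [key]
  rw [lintegral_prod_eq_prod_lintegral_of_indepFun Finset.univ (fun i ω ↦ g i (X i ω))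
    (h.comp g hgm) (fun i ↦ (hgm i).comp (hX i)),
    ← Finset.prod_subset (Finset.subset_univ S)]
  · refine Finset.prod_congr rfl fun i hi ↦ ?_
    rw [← lintegral_indicator (hX i (hs i hi))]
    simp only [hg, if_pos hi]
    rfl
  · intro i _ hi
    simp only [hg, if_neg hi, h1]

theorem map_withDensity_prod (hX : ∀ i, Measurable (X i)) (h : iIndepFun X P)
    (hf : ∀ i, Measurable (f i)) (h1 : ∀ i, ∫⁻ ω, f i (X i ω) ∂P = 1) (i : ι) :
    (P.withDensity fun ω ↦ ∏ i, f i (X i ω)).map (X i) = (P.map (X i)).withDensity (f i) := by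
  classical
  ext s hs
  have := withDensity_prod_iInter_preimage hX h hf h1 {i} (s := Function.update (fun _ ↦ ∅) i s)
    (by simpa using hs)
  simp only [Finset.mem_singleton, Set.iInter_iInter_eq_left, Function.update_self,
    Finset.prod_singleton] at this
  rw [Measure.map_apply (hX i) hs, this, withDensity_apply _ hs,
    setLIntegral_map hs (hf i) (hX i)]

/-- Independent variables remain independent under a change of measure whose density is a product
of functions of the individual variables. -/
theorem iIndepFun_withDensity_prod (hX : ∀ i, Measurable (X i)) (h : iIndepFun X P)
    (hf : ∀ i, Measurable (f i)) (h1 : ∀ i, ∫⁻ ω, f i (X i ω) ∂P = 1) :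
    iIndepFun X (P.withDensity fun ω ↦ ∏ i, f i (X i ω)) := by
  rw [iIndepFun_iff_measure_inter_preimage_eq_mul]
  intro S s hs
  rw [withDensity_prod_iInter_preimage hX h hf h1 S hs]
  refine Finset.prod_congr rfl fun i hi ↦ ?_
  rw [← Measure.map_apply (hX i) (hs i hi), map_withDensity_prod hX h hf h1,
    withDensity_apply _ (hs i hi), setLIntegral_map (hs i hi) (hf i) (hX i)]

theorem isProbabilityMeasure_withDensity_prod (hX : ∀ i, Measurable (X i)) (h : iIndepFun X P)
    (hf : ∀ i, Measurable (f i)) (h1 : ∀ i, ∫⁻ ω, f i (X i ω) ∂P = 1) :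
    IsProbabilityMeasure (P.withDensity fun ω ↦ ∏ i, f i (X i ω)) := by
  constructor
  simpa using withDensity_prod_iInter_preimage hX h hf h1 ∅ (s := fun _ ↦ ∅) (by simp)

end ProductDensity

/-! ### Gaussian vectors with independent coordinates -/

/-- The one-dimensional Cameron–Martin formula. -/
theorem gaussianReal_withDensity_exp (a : ℝ) :
    (gaussianReal 0 1).withDensity (fun x ↦ ENNReal.ofReal (Real.exp (a * x - 1 / 2 * (a * a)))) =
      gaussianReal a 1 := by
  rw [gaussianReal_of_var_ne_zero _ one_ne_zero, gaussianReal_of_var_ne_zero _ one_ne_zero,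
    ← withDensity_mul _ (measurable_gaussianPDF _ _) (by fun_prop)]
  congr 1
  ext x
  simp only [Pi.mul_apply, gaussianPDF]
  rw [← ENNReal.ofReal_mul (gaussianPDFReal_nonneg _ _ _)]
  congr 1
  simp only [gaussianPDFReal, NNReal.coe_one]
  rw [mul_assoc, ← Real.exp_add]
  ring_nf

theorem ofReal_exp_dotProduct_sub {n : ℕ} (a x : Fin n → ℝ) :
    ENNReal.ofReal (Real.exp (a ⬝ᵥ x - 1 / 2 * (a ⬝ᵥ a))) =
      ∏ k, ENNReal.ofReal (Real.exp (a k * x k - 1 / 2 * (a k * a k))) := by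
  rw [← ENNReal.ofReal_prod_of_nonneg fun _ _ ↦ (Real.exp_pos _).le, ← Real.exp_sum]
  simp only [dotProduct, Finset.mul_sum, Finset.sum_sub_distrib]

/-- The Cameron–Martin formula in `ℝⁿ`. -/
theorem pi_gaussianReal_withDensity_exp {n : ℕ} (a : Fin n → ℝ) :
    (Measure.pi fun _ : Fin n ↦ gaussianReal 0 1).withDensity
        (fun x ↦ ENNReal.ofReal (Real.exp (a ⬝ᵥ x - 1 / 2 * (a ⬝ᵥ a)))) =
      Measure.pi fun k ↦ gaussianReal (a k) 1 := by
  simp_rw [ofReal_exp_dotProduct_sub]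
  set f : Fin n → ℝ → ENNReal :=
    fun k x ↦ ENNReal.ofReal (Real.exp (a k * x - 1 / 2 * (a k * a k)))
  have hf : ∀ k, Measurable (f k) := fun k ↦ by fun_prop
  have hX : ∀ k, Measurable fun x : Fin n → ℝ ↦ x k := fun k ↦ measurable_pi_apply k
  have hmap : ∀ k, (Measure.pi fun _ : Fin n ↦ gaussianReal 0 1).map (fun x ↦ x k) =
      gaussianReal 0 1 := fun k ↦ (measurePreserving_eval _ k).map_eq
  have h : iIndepFun (fun (k : Fin n) (x : Fin n → ℝ) ↦ x k)
      (Measure.pi fun _ : Fin n ↦ gaussianReal 0 1) :=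
    iIndepFun_pi (X := fun _ ↦ id) fun _ ↦ aemeasurable_id
  have h1 : ∀ k, ∫⁻ x, f k (x k) ∂(Measure.pi fun _ : Fin n ↦ gaussianReal 0 1) = 1 := by
    intro k
    rw [← lintegral_map (hf k) (hX k), hmap, ← setLIntegral_univ,
      ← withDensity_apply _ MeasurableSet.univ, gaussianReal_withDensity_exp, measure_univ]
  have hp := isProbabilityMeasure_withDensity_prod hX h hf h1
  have hi := iIndepFun_withDensity_prod hX h hf h1
  rw [iIndepFun_iff_map_fun_eq_pi_map fun k ↦ (hX k).aemeasurable] at hi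
  simp_rw [map_withDensity_prod hX h hf h1, hmap] at hi
  rw [← Measure.map_id (μ := Measure.withDensity _ _)]
  refine hi.trans ?_
  simp_rw [f, gaussianReal_withDensity_exp]

/-- The law of a linear combination of independent normal variables with unit variance. -/
theorem map_sum_mul_gaussianReal {Ω ι : Type*} [MeasurableSpace Ω] {P : Measure Ω}
    {X : ι → Ω → ℝ} (hX : ∀ i, Measurable (X i)) (h : iIndepFun X P) (a : ι → ℝ)
    (hlaw : ∀ i, P.map (X i) = gaussianReal (a i) 1) (w : ι → ℝ) (s : Finset ι) :
    P.map (∑ i ∈ s, fun ω ↦ w i * X i ω) =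
      gaussianReal (∑ i ∈ s, w i * a i) (∑ i ∈ s, (w i ^ 2).toNNReal) := by
  classical
  have hP := h.isProbabilityMeasure
  have hw : iIndepFun (fun i ω ↦ w i * X i ω) P := h.comp (fun i x ↦ w i * x) (by fun_prop)
  induction s using Finset.induction_on with
  | empty => simp [Pi.zero_def]
  | insert i s hi ih =>
    rw [Finset.sum_insert hi, Finset.sum_insert hi, Finset.sum_insert hi]
    refine gaussianReal_add_gaussianReal_of_indepFun
      (hw.indepFun_finsetSum_of_notMem (by fun_prop) hi).symm ?_ ih
    have := gaussianReal_map_const_mul (μ := a i) (v := 1) (w i)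
    rw [← hlaw, Measure.map_map (by fun_prop) (hX i)] at this
    simpa [Function.comp_def, Real.toNNReal_of_nonneg (sq_nonneg (w i))] using this

/-- The law of a linear functional of a Gaussian vector with independent coordinates. -/
theorem pi_gaussianReal_map_dotProduct {n : ℕ} (a w : Fin n → ℝ) :
    (Measure.pi fun k ↦ gaussianReal (a k) 1).map (fun x ↦ w ⬝ᵥ x) =
      gaussianReal (w ⬝ᵥ a) (w ⬝ᵥ w).toNNReal := by
  have h : iIndepFun (fun (k : Fin n) (x : Fin n → ℝ) ↦ x k)
      (Measure.pi fun k : Fin n ↦ gaussianReal (a k) 1) :=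
    iIndepFun_pi (X := fun _ ↦ id) fun _ ↦ aemeasurable_id
  have := map_sum_mul_gaussianReal (fun k ↦ measurable_pi_apply k) h a
    (fun k ↦ (measurePreserving_eval _ k).map_eq) w Finset.univ
  rw [← Real.toNNReal_sum_of_nonneg fun k _ ↦ sq_nonneg (w k)] at this
  simp only [sq] at this
  rw [dotProduct, dotProduct, ← this]
  congr 1
  ext x
  simp [dotProduct]

/-! ### Quantile functions -/

section Quantile

variable {μ : Measure ℝ} {u : ℝ}

/-- The Galois connection between the quantile function and the distribution function. -/
theorem quantile_le_iff (h0 : 0 < u) (h1 : u < 1) (x : ℝ) : quantile μ u ≤ x ↔ u ≤ cdf μ x := by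
  have hbdd : BddBelow {x : ℝ | u ≤ cdf μ x} := by
    obtain ⟨b, hb⟩ := ((tendsto_cdf_atBot μ).eventually_lt_const h0).exists
    refine ⟨b, fun y hy ↦ ?_⟩
    by_contra! h
    exact (hb.trans_le hy).not_ge (monotone_cdf μ h.le)
  have hne : {x : ℝ | u ≤ cdf μ x}.Nonempty := by
    obtain ⟨b, hb⟩ := ((tendsto_cdf_atTop μ).eventually_const_lt h1).exists
    exact ⟨b, hb.le⟩
  constructor
  · intro h
    refine le_trans ?_ (monotone_cdf μ h)
    -- the distribution function is right-continuous at its quantile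
    have hr : Filter.Tendsto (cdf μ) (nhdsWithin (quantile μ u) (Set.Ioi (quantile μ u)))
        (nhds (cdf μ (quantile μ u))) :=
      ((cdf μ).right_continuous _).mono_left (nhdsWithin_mono _ Set.Ioi_subset_Ici_self)
    refine ge_of_tendsto hr ?_
    filter_upwards [self_mem_nhdsWithin] with y hy
    obtain ⟨z, hz, hzy⟩ := exists_lt_of_csInf_lt hne hy
    exact le_trans hz (monotone_cdf μ hzy.le)
  · intro h
    exact csInf_le hbdd h

theorem monotoneOn_quantile : MonotoneOn (quantile μ) (Set.Ioo 0 1) := by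
  intro u hu v hv huv
  rw [quantile_le_iff hu.1 hu.2]
  exact huv.trans ((quantile_le_iff hv.1 hv.2 _).1 le_rfl)

variable [IsProbabilityMeasure μ]

theorem quantile_map_affine (h0 : 0 < u) (h1 : u < 1) (a : ℝ) {c : ℝ} (hc : 0 ≤ c) :
    quantile (μ.map fun x ↦ a + c * x) u = a + c * quantile μ u := by
  have hm : Measurable fun x : ℝ ↦ a + c * x := by fun_prop
  have : IsProbabilityMeasure (μ.map fun x ↦ a + c * x) :=
    Measure.isProbabilityMeasure_map hm.aemeasurable
  refine eq_of_forall_ge_iff fun x ↦ ?_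
  rw [quantile_le_iff h0 h1, cdf_eq_real, map_measureReal_apply hm measurableSet_Iic]
  rcases hc.eq_or_lt with rfl | hc
  · by_cases hx : a ≤ x
    · simp [Set.preimage, hx, h1.le]
    · simp [Set.preimage, hx, h0]
  · have : (fun x : ℝ ↦ a + c * x) ⁻¹' Set.Iic x = Set.Iic ((x - a) / c) := by
      ext y
      rw [Set.mem_preimage, Set.mem_Iic, Set.mem_Iic, le_div_iff₀ hc, le_sub_iff_add_le',
        mul_comm y]
    rw [this, ← cdf_eq_real, ← quantile_le_iff h0 h1, le_div_iff₀ hc, le_sub_iff_add_le',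
      mul_comm c]

/-- Quantile transformation: the quantile function maps the uniform distribution to `μ`. -/
theorem map_quantile : (volume.restrict (Set.Ioo (0 : ℝ) 1)).map (quantile μ) = μ := by
  have hq : AEMeasurable (quantile μ) (volume.restrict (Set.Ioo (0 : ℝ) 1)) :=
    aemeasurable_restrict_of_monotoneOn measurableSet_Ioo monotoneOn_quantile
  have : IsFiniteMeasure ((volume.restrict (Set.Ioo (0 : ℝ) 1)).map (quantile μ)) :=
    Measure.isFiniteMeasure_map _ _
  refine Measure.ext_of_Iic _ _ fun x ↦ ?_
  have hset : quantile μ ⁻¹' Set.Iic x ∩ Set.Ioo 0 1 = Set.Iic (cdf μ x) ∩ Set.Ioo 0 1 := by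
    ext u
    simp only [Set.mem_inter_iff, Set.mem_preimage, Set.mem_Iic, and_congr_left_iff]
    exact fun hu ↦ quantile_le_iff hu.1 hu.2 x
  rw [Measure.map_apply_of_aemeasurable hq measurableSet_Iic,
    Measure.restrict_apply₀' measurableSet_Ioo.nullMeasurableSet, hset, ← ofReal_cdf]
  refine le_antisymm ?_ ?_
  · refine (measure_mono (t := Set.Icc 0 (cdf μ x)) fun u hu ↦ ⟨hu.2.1.le, hu.1⟩).trans ?_
    simp
  · refine le_trans ?_ (measure_mono (s := Set.Ioo 0 (cdf μ x))
      fun u hu ↦ ⟨hu.2.le, hu.1, hu.2.trans_le (cdf_le_one μ x)⟩)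
    simp

/-- The quantile function of an integrable distribution is integrable with respect to a mixing
distribution: it is integrable for the uniform distribution by the quantile transformation, and
it is bounded on compact subintervals of `(0,1)`. -/
theorem IsMixingDistribution.integrable_quantile {M : Measure ℝ} (hM : IsMixingDistribution M)
    (hμ : Integrable id μ) : Integrable (quantile μ) M := by
  have := hM.isProbabilityMeasure
  have hres : M.restrict (Set.Ioo 0 1) = M := Measure.restrict_eq_self_of_ae_mem hM.concentrated
  have hq : AEMeasurable (quantile μ) M := by
    rw [← hres]
    exact aemeasurable_restrict_of_monotoneOn measurableSet_Ioo monotoneOn_quantile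
  rcases hM.bounded_density_or_support with ⟨f, c, hf, hfc, hMf⟩ | ⟨a, b, ha, hb, hab⟩
  · have hle : M ≤ (c : ENNReal) • volume.restrict (Set.Ioo 0 1) := by
      rw [← hres, hMf, restrict_withDensity measurableSet_Ioo, ← withDensity_const]
      exact withDensity_mono (Filter.Eventually.of_forall hfc)
    have hu : Integrable (quantile μ) (volume.restrict (Set.Ioo 0 1)) := by
      have h := hμ
      rw [← map_quantile (μ := μ), integrable_map_measure aestronglyMeasurable_id
        (aemeasurable_restrict_of_monotoneOn measurableSet_Ioo monotoneOn_quantile)] at h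
      exact h
    exact (hu.smul_measure ENNReal.coe_ne_top).mono_measure hle
  · refine Integrable.of_bound hq.aestronglyMeasurable
      (max |quantile μ a| |quantile μ b|) ?_
    have hmem : ∀ᵐ u ∂M, u ∈ Set.Icc a b := hab
    filter_upwards [hmem] with u hu
    have h1 := monotoneOn_quantile (μ := μ) ⟨ha, (hu.1.trans hu.2).trans_lt hb⟩
      ⟨ha.trans_le hu.1, hu.2.trans_lt hb⟩ hu.1
    have h2 := monotoneOn_quantile (μ := μ) ⟨ha.trans_le hu.1, hu.2.trans_lt hb⟩
      ⟨ha.trans_le (hu.1.trans hu.2), hb⟩ hu.2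
    exact abs_le_max_abs_abs h1 h2

end Quantile

/-! ### The risk measure of a Gaussian increment -/

/-- Given `X`, the sum of a function of `X` and a variable independent of `X` has the law of that
variable translated by the value of the function. -/
theorem condDistrib_add_of_indepFun {α β : Type*} {mα : MeasurableSpace α}
    {mβ : MeasurableSpace β} {μ : Measure α} [IsProbabilityMeasure μ] {X : α → β} {η : α → ℝ}
    {H : β → ℝ} (hX : Measurable X) (hη : Measurable η) (hH : Measurable H)
    (hind : IndepFun X η μ) :
    ∀ᵐ b ∂(μ.map X), condDistrib (fun a ↦ H (X a) + η a) X μ b =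
      (μ.map η).map fun y ↦ H b + y := by
  have : IsProbabilityMeasure (μ.map η) := Measure.isProbabilityMeasure_map hη.aemeasurable
  let κ : Kernel β ℝ := (Kernel.id ×ₖ Kernel.const β (μ.map η)).map fun p ↦ H p.1 + p.2
  have hκm : Measurable fun p : β × ℝ ↦ H p.1 + p.2 := by fun_prop
  have hκ : ∀ b, κ b = (μ.map η).map fun y ↦ H b + y := by
    intro b
    simp only [κ]
    rw [Kernel.map_apply _ hκm, Kernel.prod_apply, Kernel.id_apply, Kernel.const_apply,
      Measure.dirac_prod, Measure.map_map hκm (by fun_prop)]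
    rfl
  have : IsMarkovKernel κ := Kernel.IsMarkovKernel.map _ hκm
  simp_rw [← hκ]
  refine condDistrib_ae_eq_of_measure_eq_compProd_of_measurable hX (by fun_prop) ?_
  have hp := (indepFun_iff_map_prod_eq_prod_map_map hX.aemeasurable hη.aemeasurable).1 hind
  have hg : Measurable fun p : β × ℝ ↦ (p.1, H p.1 + p.2) := by fun_prop
  have h1 : μ.map (fun a ↦ (X a, H (X a) + η a)) =
      ((μ.map X).prod (μ.map η)).map fun p ↦ (p.1, H p.1 + p.2) := by
    rw [← hp, Measure.map_map hg (by fun_prop)]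
    rfl
  rw [h1]
  ext s hs
  rw [Measure.map_apply hg hs, Measure.prod_apply (hg hs), Measure.compProd_apply hs]
  refine lintegral_congr fun b ↦ ?_
  rw [hκ, Measure.map_apply (by fun_prop) (measurable_prodMk_left hs)]
  rfl

/-- If `-Z = H + η`, where `H` is known and `η` is an independent centred normal variable with
standard deviation `σ`, then the risk of `Z` is `H + σ r₀`. -/
theorem condRiskMeasure_ae_eq {Ω : Type*} {m mΩ : MeasurableSpace Ω} {P : Measure Ω}
    [IsProbabilityMeasure P] (hm : m ≤ mΩ) {M : Measure ℝ}
    (hM : IsMixingDistribution M) {Z H η : Ω → ℝ} {σ : ℝ} (hσ : 0 ≤ σ) (hH : Measurable[m] H)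
    (hη : Measurable η) (hlaw : P.map η = gaussianReal 0 (σ ^ 2).toNNReal)
    (hind : Indep m (MeasurableSpace.comap η inferInstance) P)
    (hZ : ∀ᵐ ω ∂P, -Z ω = H ω + η ω) :
    condRiskMeasure P m M Z =ᵐ[P] fun ω ↦ H ω + σ * rZero M := by
  have := hM.isProbabilityMeasure
  have hid : @Measurable Ω Ω mΩ m id := measurable_id'' hm
  -- conditioning on `m` is conditioning on the identity with values in `(Ω, m)`
  have hindf : @IndepFun Ω Ω ℝ mΩ m _ id η P := by
    refine (@IndepFun_iff_Indep Ω Ω ℝ mΩ m _ id η P).2 ?_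
    rwa [MeasurableSpace.comap_id]
  have hc := @condDistrib_add_of_indepFun Ω Ω mΩ m P _ id η H hid hη hH hindf
  have hcongr : @condDistrib Ω Ω ℝ _ _ _ mΩ m (fun ω ↦ -Z ω) id P _ =
      @condDistrib Ω Ω ℝ _ _ _ mΩ m (fun ω ↦ H (id ω) + η ω) id P _ :=
    condDistrib_congr_left hZ
  have hc' := @ae_of_ae_map Ω Ω mΩ m P id (@Measurable.aemeasurable Ω Ω mΩ m id P hid) _ hc
  filter_upwards [hc'] with ω hω
  have hd : (P.map η).map (fun y ↦ H ω + y) =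
      (gaussianReal 0 1).map fun x ↦ H ω + σ * x := by
    have h1 := gaussianReal_map_const_mul (μ := 0) (v := 1) σ
    have h2 : (NNReal.mk (σ ^ 2) (sq_nonneg σ)) * 1 = (σ ^ 2).toNNReal := by
      rw [Real.toNNReal_of_nonneg (sq_nonneg σ), mul_one]
    rw [mul_zero] at h1
    rw [hlaw, ← h2, ← h1, Measure.map_map (by fun_prop) (by fun_prop)]
    rfl
  have hint : Integrable (quantile (gaussianReal 0 1)) M :=
    hM.integrable_quantile ((memLp_id_gaussianReal 1).integrable le_rfl)
  have hmem : ∀ᵐ u ∂M, u ∈ Set.Ioo (0 : ℝ) 1 := hM.concentrated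
  calc condRiskMeasure P m M Z ω
      = ∫ u, quantile ((gaussianReal 0 1).map fun x ↦ H ω + σ * x) u ∂M := by
        rw [condRiskMeasure, hcongr, ← hd]
        rw [id] at hω
        rw [hω]
    _ = ∫ u, (H ω + σ * quantile (gaussianReal 0 1) u) ∂M := by
        refine integral_congr_ae ?_
        filter_upwards [hmem] with u hu
        exact quantile_map_affine hu.1 hu.2 _ hσ
    _ = H ω + σ * rZero M := by
        rw [integral_add (integrable_const _) (hint.const_mul σ), integral_const_mul, rZero]
        simp

/-! ### Optimal stopping in discrete time -/

section OptimalStopping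

variable {Ω : Type*} {mΩ : MeasurableSpace Ω} {T : ℕ}

/-- The payoff `∑_{s=t+1}^{τ-1} X_s + R_{τ-1}` of stopping at time `τ`. Here `X i` is the cash flow
at time `i + 1`. -/
def stoppingPayoff (X : Fin T → Ω → ℝ) (R : ℕ → Ω → ℝ) (t : ℕ) (τ : Ω → ℕ) (ω : Ω) : ℝ :=
  (∑ i ∈ Finset.univ.filter (fun i : Fin T ↦ t ≤ (i : ℕ) ∧ (i : ℕ) + 1 < τ ω), X i ω)
    + R (τ ω - 1) ω

variable {X : Fin T → Ω → ℝ} {R V : ℕ → Ω → ℝ}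

theorem stoppingPayoff_of_eq {t : ℕ} {τ : Ω → ℕ} {ω : Ω} (h : τ ω = t + 1) :
    stoppingPayoff X R t τ ω = R t ω := by
  have : Finset.univ.filter (fun i : Fin T ↦ t ≤ (i : ℕ) ∧ (i : ℕ) + 1 < τ ω) = ∅ := by
    ext i
    simp only [Finset.mem_filter, Finset.mem_univ, true_and, Finset.notMem_empty, iff_false]
    omega
  rw [stoppingPayoff, this, h]
  simp

theorem stoppingPayoff_of_lt {t : ℕ} (ht : t < T) {τ τ' : Ω → ℕ} {ω : Ω} (h : t + 1 < τ ω)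
    (h' : τ' ω = τ ω) :
    stoppingPayoff X R t τ ω = X ⟨t, ht⟩ ω + stoppingPayoff X R (t + 1) τ' ω := by
  have : Finset.univ.filter (fun i : Fin T ↦ t ≤ (i : ℕ) ∧ (i : ℕ) + 1 < τ ω) =
      insert ⟨t, ht⟩
        (Finset.univ.filter (fun i : Fin T ↦ t + 1 ≤ (i : ℕ) ∧ (i : ℕ) + 1 < τ' ω)) := by
    ext i
    simp only [Finset.mem_filter, Finset.mem_univ, true_and, Finset.mem_insert, Fin.ext_iff]
    omega
  rw [stoppingPayoff, this, Finset.sum_insert (by simp), stoppingPayoff, h', add_assoc]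

/-- The rule "stop at `s` on `A`, follow `τ` otherwise" is a stopping time. -/
theorem isStoppingTime_ite {ℱ : Filtration ℕ mΩ} {s : ℕ} {A : Set Ω} [DecidablePred (· ∈ A)]
    (hA : MeasurableSet[ℱ s] A) {τ : Ω → ℕ}
    (hτ : IsStoppingTime ℱ (fun ω ↦ (τ ω : WithTop ℕ))) (hs : ∀ ω, s ≤ τ ω) :
    IsStoppingTime ℱ (fun ω ↦ ((if ω ∈ A then s else τ ω : ℕ) : WithTop ℕ)) := by
  intro i
  by_cases hi : s ≤ i
  · have : {ω | ((if ω ∈ A then s else τ ω : ℕ) : WithTop ℕ) ≤ i} =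
        A ∪ {ω | (τ ω : WithTop ℕ) ≤ i} := by
      ext ω
      by_cases hω : ω ∈ A <;> simp [hω, hi]
    change MeasurableSet[ℱ i] {ω | ((if ω ∈ A then s else τ ω : ℕ) : WithTop ℕ) ≤ i}
    rw [this]
    exact (ℱ.mono hi _ hA).union (hτ i)
  · have : {ω | ((if ω ∈ A then s else τ ω : ℕ) : WithTop ℕ) ≤ i} = ∅ := by
      ext ω
      have := hs ω
      by_cases hω : ω ∈ A
      · simpa [hω] using hi
      · simp only [hω, if_false, Set.mem_ofPred_eq, Nat.cast_le, Set.mem_empty_iff_false, iff_false]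
        omega
    change MeasurableSet[ℱ i] {ω | ((if ω ∈ A then s else τ ω : ℕ) : WithTop ℕ) ≤ i}
    rw [this]
    exact @MeasurableSet.empty _ (ℱ i)

variable {Q : Measure Ω}

/-- One step of the dynamic programming argument: conditioning a payoff that stops on `A` with
reward `r`, and otherwise pays `x` and continues with `w`. -/
theorem condExp_indicator_add_indicator_compl [IsProbabilityMeasure Q] {m : MeasurableSpace Ω}
    (hm : m ≤ mΩ) {A : Set Ω} (hA : MeasurableSet[m] A) {r x w : Ω → ℝ}
    (hr : AEStronglyMeasurable[m] r Q) (hri : Integrable r Q)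
    (hx : AEStronglyMeasurable[m] x Q) (hxi : Integrable x Q) (hwi : Integrable w Q) :
    Q[A.indicator r + Aᶜ.indicator (x + w) | m] =ᵐ[Q]
      A.indicator r + Aᶜ.indicator (x + Q[w | m]) := by
  have h1 := condExp_add (m := m) (hri.indicator (hm _ hA))
    ((hxi.add hwi).indicator (hm _ hA).compl)
  have h2 := condExp_indicator (m := m) hri hA
  have h3 := condExp_indicator (m := m) (hxi.add hwi) hA.compl
  have h4 := condExp_add (m := m) hxi hwi
  have h5 := condExp_of_aestronglyMeasurable' hm hr hri
  have h6 := condExp_of_aestronglyMeasurable' hm hx hxi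
  filter_upwards [h1, h2, h3, h4, h5, h6] with ω e1 e2 e3 e4 e5 e6
  rw [e1]
  simp only [Pi.add_apply] at *
  rw [e2, e3]
  by_cases hω : ω ∈ A <;> simp [*]

/-- Data of an optimal stopping problem for which the backward recursion
`V_t = E_t[min(R_t, X_{t+1} + V_{t+1})]`, `V_T = R_T = 0`, holds. Here `X i` is the cash flow at
time `i + 1`, and adaptedness is required up to null sets. -/
structure IsSnellRecursion (Q : Measure Ω) (ℱ : Filtration ℕ mΩ) (X : Fin T → Ω → ℝ)
    (R V : ℕ → Ω → ℝ) : Prop where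
  cashflow_meas : ∀ i : Fin T, AEStronglyMeasurable[ℱ ((i : ℕ) + 1)] (X i) Q
  cashflow_int : ∀ i : Fin T, Integrable (X i) Q
  capital_meas : ∀ t < T, AEStronglyMeasurable[ℱ t] (R t) Q
  capital_int : ∀ t < T, Integrable (R t) Q
  value_meas : ∀ t ≤ T, AEStronglyMeasurable[ℱ t] (V t) Q
  value_int : ∀ t ≤ T, Integrable (V t) Q
  capital_terminal : R T = 0
  value_terminal : V T = 0
  recursion : ∀ (t : ℕ) (ht : t < T),
    V t =ᵐ[Q] Q[fun ω ↦ min (R t ω) (X ⟨t, ht⟩ ω + V (t + 1) ω) | ℱ t]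

namespace IsSnellRecursion

variable {ℱ : Filtration ℕ mΩ} (h : IsSnellRecursion Q ℱ X R V)
include h

theorem stoppingPayoff_terminal {τ : Ω → ℕ} (hτ : ∀ ω, T + 1 ≤ τ ω ∧ τ ω ≤ T + 1) :
    stoppingPayoff X R T τ = 0 := by
  ext ω
  rw [stoppingPayoff_of_eq (le_antisymm (hτ ω).2 (hτ ω).1), h.capital_terminal]

variable [IsProbabilityMeasure Q]

/-- Every stopping rule yields at least the value in expectation. -/
theorem value_le_condExp_stoppingPayoff (k : ℕ) : ∀ (t : ℕ), t + k = T → ∀ τ : Ω → ℕ,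
    IsStoppingTime ℱ (fun ω ↦ (τ ω : WithTop ℕ)) → (∀ ω, t + 1 ≤ τ ω ∧ τ ω ≤ T + 1) →
    Integrable (stoppingPayoff X R t τ) Q ∧ V t ≤ᵐ[Q] Q[stoppingPayoff X R t τ | ℱ t] := by
  induction k with
  | zero =>
    intro t htk τ _ hτ'
    obtain rfl : t = T := by omega
    rw [h.stoppingPayoff_terminal hτ', h.value_terminal, condExp_zero]
    exact ⟨integrable_zero _ _ _, Filter.EventuallyLE.refl _ _⟩
  | succ k ih =>
    intro t htk τ hτ hτ'
    have ht : t < T := by omega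
    -- off the event `τ = t + 1`, the rule `τ` agrees with one that is admissible from `t + 1` on
    let τ' : Ω → ℕ := fun ω ↦ max (τ ω) (t + 2)
    have hτs : IsStoppingTime ℱ (fun ω ↦ (τ' ω : WithTop ℕ)) := by
      have : (fun ω ↦ (τ' ω : WithTop ℕ)) =
          fun ω ↦ max (τ ω : WithTop ℕ) ((t + 2 : ℕ) : WithTop ℕ) :=
        funext fun ω ↦ WithTop.coe_max _ _
      rw [this]
      exact hτ.max_const (t + 2)
    have hτ'' : ∀ ω, t + 1 + 1 ≤ τ' ω ∧ τ' ω ≤ T + 1 := by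
      intro ω
      have := hτ' ω
      simp only [τ']
      omega
    obtain ⟨hint, hle⟩ := ih (t + 1) (by omega) τ' hτs hτ''
    set W := stoppingPayoff X R (t + 1) τ' with hW
    set A : Set Ω := {ω | (τ ω : WithTop ℕ) ≤ ((t + 1 : ℕ) : WithTop ℕ)} with hAdef
    have hA : MeasurableSet[ℱ (t + 1)] A := hτ (t + 1)
    have hmemA : ∀ ω, ω ∈ A ↔ τ ω = t + 1 := by
      intro ω
      have := hτ' ω
      simp only [hAdef, Set.mem_ofPred_eq, Nat.cast_le]
      omega
    have hdec : stoppingPayoff X R t τ =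
        A.indicator (R t) + Aᶜ.indicator (X ⟨t, ht⟩ + W) := by
      ext ω
      by_cases hω : ω ∈ A
      · simp [hω, stoppingPayoff_of_eq ((hmemA ω).1 hω)]
      · have h1 := hτ' ω
        have h2 := mt (hmemA ω).2 hω
        have h3 : t + 1 < τ ω := by omega
        simp [hω, stoppingPayoff_of_lt ht h3 (show τ' ω = τ ω by simp only [τ']; omega), hW]
    have hAm := ℱ.le _ _ hA
    have hWx := (h.cashflow_int ⟨t, ht⟩).add hint
    have hZ : Integrable (stoppingPayoff X R t τ) Q := by
      rw [hdec]
      exact ((h.capital_int t ht).indicator hAm).add (hWx.indicator hAm.compl)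
    refine ⟨hZ, ?_⟩
    have hmin : Integrable (fun ω ↦ min (R t ω) (X ⟨t, ht⟩ ω + V (t + 1) ω)) Q :=
      (h.capital_int t ht).inf ((h.cashflow_int _).add (h.value_int (t + 1) ht))
    have hcond := condExp_indicator_add_indicator_compl (ℱ.le (t + 1)) hA
      ((h.capital_meas t ht).mono (ℱ.mono t.le_succ)) (h.capital_int t ht)
      (h.cashflow_meas ⟨t, ht⟩) (h.cashflow_int _) hint
    rw [← hdec] at hcond
    have hge : (fun ω ↦ min (R t ω) (X ⟨t, ht⟩ ω + V (t + 1) ω)) ≤ᵐ[Q]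
        Q[stoppingPayoff X R t τ | ℱ (t + 1)] := by
      filter_upwards [hcond, hle] with ω e1 e2
      rw [e1]
      by_cases hω : ω ∈ A
      · simp [hω]
      · simp [hω, e2]
    exact (h.recursion t ht).trans_le
      ((condExp_mono hmin integrable_condExp hge).trans_eq
        (condExp_condExp_of_le (ℱ.mono t.le_succ) (ℱ.le _)))

/-- Stopping as soon as `R_t ≤ X_{t+1} + V_{t+1}` yields exactly the value. -/
theorem exists_condExp_stoppingPayoff_eq (k : ℕ) : ∀ (t : ℕ), t + k = T → ∃ τ : Ω → ℕ,
    IsStoppingTime ℱ (fun ω ↦ (τ ω : WithTop ℕ)) ∧ (∀ ω, t + 1 ≤ τ ω ∧ τ ω ≤ T + 1) ∧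
    V t =ᵐ[Q] Q[stoppingPayoff X R t τ | ℱ t] := by
  classical
  induction k with
  | zero =>
    intro t htk
    obtain rfl : t = T := by omega
    refine ⟨fun _ ↦ t + 1, isStoppingTime_const ℱ (t + 1), fun _ ↦ ⟨le_rfl, le_rfl⟩, ?_⟩
    rw [h.stoppingPayoff_terminal fun _ ↦ ⟨le_rfl, le_rfl⟩, h.value_terminal, condExp_zero]
  | succ k ih =>
    intro t htk
    have ht : t < T := by omega
    obtain ⟨τ', hτs, hτ', hV⟩ := ih (t + 1) (by omega)
    obtain ⟨hint, -⟩ := h.value_le_condExp_stoppingPayoff k (t + 1) (by omega) τ' hτs hτ'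
    set W := stoppingPayoff X R (t + 1) τ' with hW
    have hRm := (h.capital_meas t ht).mono (ℱ.mono t.le_succ)
    have hYm := (h.cashflow_meas ⟨t, ht⟩).add (h.value_meas (t + 1) ht)
    -- the stopping region has to be measurable, not only up to null sets
    set A : Set Ω := {ω | hRm.mk _ ω ≤ hYm.mk _ ω}
    have hA : MeasurableSet[ℱ (t + 1)] A :=
      hRm.stronglyMeasurable_mk.measurableSet_le hYm.stronglyMeasurable_mk
    let τ : Ω → ℕ := fun ω ↦ if ω ∈ A then t + 1 else τ' ω
    have hτ : ∀ ω, t + 1 ≤ τ ω ∧ τ ω ≤ T + 1 := by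
      intro ω
      have := hτ' ω
      simp only [τ]
      split_ifs <;> omega
    refine ⟨τ, isStoppingTime_ite hA hτs fun ω ↦ by have := hτ' ω; omega, hτ, ?_⟩
    have hdec : stoppingPayoff X R t τ =
        A.indicator (R t) + Aᶜ.indicator (X ⟨t, ht⟩ + W) := by
      ext ω
      by_cases hω : ω ∈ A
      · simp [hω, stoppingPayoff_of_eq (show τ ω = t + 1 by simp [τ, hω])]
      · have h1 := hτ' ω
        have h2 : τ ω = τ' ω := by simp [τ, hω]
        simp [hω, stoppingPayoff_of_lt ht (show t + 1 < τ ω by omega) h2.symm, hW]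
    have hcond := condExp_indicator_add_indicator_compl (ℱ.le (t + 1)) hA
      hRm (h.capital_int t ht) (h.cashflow_meas ⟨t, ht⟩) (h.cashflow_int _) hint
    rw [← hdec] at hcond
    have heq : (fun ω ↦ min (R t ω) (X ⟨t, ht⟩ ω + V (t + 1) ω)) =ᵐ[Q]
        Q[stoppingPayoff X R t τ | ℱ (t + 1)] := by
      filter_upwards [hcond, hV, hRm.ae_eq_mk, hYm.ae_eq_mk] with ω e1 e2 e3 e4
      rw [e1]
      have hiff : ω ∈ A ↔ R t ω ≤ X ⟨t, ht⟩ ω + V (t + 1) ω := by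
        change hRm.mk _ ω ≤ hYm.mk _ ω ↔ _
        rw [← e3, ← e4]
        rfl
      by_cases hω : ω ∈ A
      · simp [hω, hiff.1 hω]
      · have := (not_le.1 (mt hiff.2 hω)).le
        simp [hω, ← e2, this]
    exact (h.recursion t ht).trans ((condExp_congr_ae heq).trans
      (condExp_condExp_of_le (ℱ.mono t.le_succ) (ℱ.le _)))

end IsSnellRecursion

end OptimalStopping

namespace GaussianModel

variable {Ω : Type*} [mΩ : MeasurableSpace Ω] {P : Measure Ω} {T n : ℕ}

/-! ### Innovations and the filtration -/

theorem measurable_G_filtration (𝓜 : GaussianModel P T n) {t : ℕ} {i : Fin T} (hi : (i : ℕ) < t) :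
    Measurable[𝓜.filtration t] (𝓜.G i) := by
  have h : MeasurableSpace.comap (𝓜.G i) inferInstance ≤ 𝓜.filtration t :=
    le_iSup₂_of_le (f := fun (i : Fin T) (_ : (i : ℕ) < t) ↦
      MeasurableSpace.comap (𝓜.G i) inferInstance) i hi le_rfl
  exact (comap_measurable (𝓜.G i)).mono h le_rfl

/-- Since the matrices `B_{t,t}` are invertible, the innovations can be recovered from `G`. -/
theorem measurable_ε_filtration (𝓜 : GaussianModel P T n) {t : ℕ} (i : Fin T) (hi : (i : ℕ) < t) :
    Measurable[𝓜.filtration t] (𝓜.ε i) := by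
  induction i using WellFoundedLT.induction with
  | ind i ih =>
    have hε : 𝓜.ε i = fun ω ↦ ((𝓜.B i i)⁻¹).mulVec
        (𝓜.G i ω - 𝓜.A i - ∑ j ∈ Finset.Iio i, (𝓜.B i j).mulVec (𝓜.ε j ω)) := by
      ext1 ω
      have : 𝓜.G i ω - 𝓜.A i - ∑ j ∈ Finset.Iio i, (𝓜.B i j).mulVec (𝓜.ε j ω) =
          (𝓜.B i i).mulVec (𝓜.ε i ω) := by
        rw [G, ← Finset.Iio_insert, Finset.sum_insert (by simp)]
        abel
      rw [this, Matrix.mulVec_mulVec,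
        Matrix.nonsing_inv_mul _ (isUnit_iff_ne_zero.2 (𝓜.det_B_ne_zero i)), Matrix.one_mulVec]
    have hG := 𝓜.measurable_G_filtration hi
    have hj : ∀ j ∈ Finset.Iio i, Measurable[𝓜.filtration t] (𝓜.ε j) := fun j hj ↦
      ih j (Finset.mem_Iio.1 hj) (lt_trans (Fin.lt_def.1 (Finset.mem_Iio.1 hj)) hi)
    have hsum : Measurable[𝓜.filtration t]
        fun ω ↦ ∑ j ∈ Finset.Iio i, (𝓜.B i j).mulVec (𝓜.ε j ω) :=
      Finset.measurable_fun_sum _ fun j hj' ↦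
        (Continuous.matrix_mulVec continuous_const continuous_id).measurable.comp (hj j hj')
    rw [hε]
    exact (Continuous.matrix_mulVec continuous_const continuous_id).measurable.comp
      ((hG.sub_const _).sub hsum)

/-- The information generated by `G` is contained in that generated by the past innovations. -/
theorem filtration_le_iSup_comap_ε (𝓜 : GaussianModel P T n) (t : ℕ) :
    𝓜.filtration t ≤ ⨆ i ∈ {i : Fin T | (i : ℕ) < t},
      MeasurableSpace.comap (𝓜.ε i) inferInstance := by
  refine iSup₂_le fun i hi ↦ ?_
  rw [← measurable_iff_comap_le]
  have hj : ∀ j ∈ Finset.Iic i, Measurable[⨆ i ∈ {i : Fin T | (i : ℕ) < t},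
      MeasurableSpace.comap (𝓜.ε i) inferInstance] (𝓜.ε j) := by
    intro j hj
    have : j ∈ {i : Fin T | (i : ℕ) < t} :=
      lt_of_le_of_lt (Fin.le_def.1 (Finset.mem_Iic.1 hj)) hi
    exact (comap_measurable (𝓜.ε j)).mono
      (le_iSup₂_of_le (f := fun (i : Fin T) (_ : i ∈ {i : Fin T | (i : ℕ) < t}) ↦
        MeasurableSpace.comap (𝓜.ε i) inferInstance) j this le_rfl) le_rfl
  exact (Finset.measurable_fun_sum _ fun j hj' ↦
    (Continuous.matrix_mulVec continuous_const continuous_id).measurable.comp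
      (hj j hj')).const_add _

theorem indep_filtration_ε (𝓜 : GaussianModel P T n) {μ : Measure Ω} (h : iIndepFun 𝓜.ε μ)
    (i : Fin T) :
    Indep (𝓜.filtration i) (MeasurableSpace.comap (𝓜.ε i) inferInstance) μ := by
  have hd : Disjoint {j : Fin T | (j : ℕ) < i} {i} := by simp
  refine indep_of_indep_of_le_left (indep_of_indep_of_le_right
    (indep_iSup_of_disjoint (fun j ↦ (𝓜.measurable_ε j).comap_le) h hd) ?_)
    (𝓜.filtration_le_iSup_comap_ε i)
  simp

/-! ### The pricing measure -/

/-- The contribution `exp (λ_iᵀ x - λ_iᵀ λ_i / 2)` of one period to the density of `Q`. -/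
noncomputable def densityFactor (𝓜 : GaussianModel P T n) (i : Fin T) (x : Fin n → ℝ) : ENNReal :=
  ENNReal.ofReal (Real.exp (𝓜.lam i ⬝ᵥ x - 1 / 2 * (𝓜.lam i ⬝ᵥ 𝓜.lam i)))

theorem measurable_densityFactor (𝓜 : GaussianModel P T n) (i : Fin T) :
    Measurable (𝓜.densityFactor i) := by
  unfold densityFactor dotProduct
  fun_prop

theorem Q_eq_withDensity_prod (𝓜 : GaussianModel P T n) :
    𝓜.Q = P.withDensity fun ω ↦ ∏ i, 𝓜.densityFactor i (𝓜.ε i ω) := by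
  simp only [Q, D, densityFactor, Fin.is_lt, Finset.filter_true, Real.exp_sum]
  congr 1
  ext ω
  exact ENNReal.ofReal_prod_of_nonneg fun _ _ ↦ (Real.exp_pos _).le

theorem lintegral_densityFactor (𝓜 : GaussianModel P T n) (i : Fin T) :
    ∫⁻ ω, 𝓜.densityFactor i (𝓜.ε i ω) ∂P = 1 := by
  rw [← lintegral_map (𝓜.measurable_densityFactor i) (𝓜.measurable_ε i), 𝓜.law_ε,
    ← setLIntegral_univ, ← withDensity_apply _ MeasurableSet.univ]
  unfold densityFactor
  rw [pi_gaussianReal_withDensity_exp, measure_univ]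

instance isProbabilityMeasure_Q (𝓜 : GaussianModel P T n) : IsProbabilityMeasure 𝓜.Q := by
  rw [Q_eq_withDensity_prod]
  exact isProbabilityMeasure_withDensity_prod 𝓜.measurable_ε 𝓜.indep_ε
    𝓜.measurable_densityFactor 𝓜.lintegral_densityFactor

theorem iIndepFun_ε_Q (𝓜 : GaussianModel P T n) : iIndepFun 𝓜.ε 𝓜.Q := by
  rw [Q_eq_withDensity_prod]
  exact iIndepFun_withDensity_prod 𝓜.measurable_ε 𝓜.indep_ε
    𝓜.measurable_densityFactor 𝓜.lintegral_densityFactor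

/-- Girsanov's theorem: under `Q` the innovation `ε_i` is normal with mean `λ_i`. -/
theorem map_ε_Q (𝓜 : GaussianModel P T n) (i : Fin T) :
    𝓜.Q.map (𝓜.ε i) = Measure.pi fun k ↦ gaussianReal (𝓜.lam i k) 1 := by
  rw [Q_eq_withDensity_prod, map_withDensity_prod 𝓜.measurable_ε 𝓜.indep_ε
    𝓜.measurable_densityFactor 𝓜.lintegral_densityFactor, 𝓜.law_ε]
  exact pi_gaussianReal_withDensity_exp _

theorem Q_absolutelyContinuous (𝓜 : GaussianModel P T n) : 𝓜.Q ≪ P :=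
  withDensity_absolutelyContinuous _ _

theorem absolutelyContinuous_Q (𝓜 : GaussianModel P T n) : P ≪ 𝓜.Q := by
  rw [Q_eq_withDensity_prod]
  refine withDensity_absolutelyContinuous' ?_ (Filter.Eventually.of_forall fun ω ↦ ?_)
  · exact (Finset.measurable_fun_prod _ fun i _ ↦
      (𝓜.measurable_densityFactor i).comp (𝓜.measurable_ε i)).aemeasurable
  · exact Finset.prod_ne_zero_iff.2 fun i _ ↦ (ENNReal.ofReal_pos.2 (Real.exp_pos _)).ne'

theorem measurable_dotProduct_ε (𝓜 : GaussianModel P T n) (i : Fin T) (w : Fin n → ℝ) :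
    Measurable fun ω ↦ w ⬝ᵥ 𝓜.ε i ω :=
  (continuous_const.dotProduct continuous_id).measurable.comp (𝓜.measurable_ε i)

theorem map_dotProduct_ε (𝓜 : GaussianModel P T n) (i : Fin T) (w : Fin n → ℝ) :
    P.map (fun ω ↦ w ⬝ᵥ 𝓜.ε i ω) = gaussianReal 0 (w ⬝ᵥ w).toNNReal := by
  have h := pi_gaussianReal_map_dotProduct (fun _ ↦ 0) w
  rw [← 𝓜.law_ε i, Measure.map_map (continuous_const.dotProduct continuous_id').measurable
    (𝓜.measurable_ε i)] at h
  simpa [Function.comp_def, dotProduct] using h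

theorem map_dotProduct_ε_Q (𝓜 : GaussianModel P T n) (i : Fin T) (w : Fin n → ℝ) :
    𝓜.Q.map (fun ω ↦ w ⬝ᵥ 𝓜.ε i ω) = gaussianReal (w ⬝ᵥ 𝓜.lam i) (w ⬝ᵥ w).toNNReal := by
  have h := pi_gaussianReal_map_dotProduct (𝓜.lam i) w
  rw [← 𝓜.map_ε_Q i, Measure.map_map (continuous_const.dotProduct continuous_id').measurable
    (𝓜.measurable_ε i)] at h
  exact h

theorem integrable_dotProduct_ε (𝓜 : GaussianModel P T n) (i : Fin T) (w : Fin n → ℝ) :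
    Integrable (fun ω ↦ w ⬝ᵥ 𝓜.ε i ω) 𝓜.Q := by
  have h : Integrable id (𝓜.Q.map fun ω ↦ w ⬝ᵥ 𝓜.ε i ω) := by
    rw [map_dotProduct_ε_Q]
    exact (memLp_id_gaussianReal 1).integrable le_rfl
  exact h.comp_measurable (𝓜.measurable_dotProduct_ε i w)

theorem integral_dotProduct_ε (𝓜 : GaussianModel P T n) (i : Fin T) (w : Fin n → ℝ) :
    ∫ ω, w ⬝ᵥ 𝓜.ε i ω ∂𝓜.Q = w ⬝ᵥ 𝓜.lam i := by
  have h := integral_map (μ := 𝓜.Q) (𝓜.measurable_dotProduct_ε i w).aemeasurable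
    (f := fun x : ℝ ↦ x) aestronglyMeasurable_id
  rw [← h, map_dotProduct_ε_Q, integral_id_gaussianReal]

/-! ### Linear cash flows and their predictable parts -/

/-- The part `∑_{u > t} gᵀ(A_u + ∑_{s ≤ t} B_{u,s} ε_s)` of the cash flows of `gᵀ G` after time `t`
that is known at time `t`. An index `u : Fin T` stands for the time `u + 1`, so that `t ≤ u` means
`u + 1 > t`, and `j < t` means `j + 1 ≤ t`. -/
def knownPart (𝓜 : GaussianModel P T n) (g : Fin n → ℝ) (t : ℕ) (ω : Ω) : ℝ :=
  ∑ u ∈ Finset.univ.filter (fun u : Fin T ↦ t ≤ (u : ℕ)), (g ⬝ᵥ 𝓜.A u +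
    ∑ j ∈ (Finset.Iic u).filter (fun j : Fin T ↦ (j : ℕ) < t),
      Matrix.vecMul g (𝓜.B u j) ⬝ᵥ 𝓜.ε j ω)

theorem dotProduct_G (𝓜 : GaussianModel P T n) (g : Fin n → ℝ) (i : Fin T) (ω : Ω) :
    g ⬝ᵥ 𝓜.G i ω =
      g ⬝ᵥ 𝓜.A i + ∑ j ∈ Finset.Iic i, Matrix.vecMul g (𝓜.B i j) ⬝ᵥ 𝓜.ε j ω := by
  simp only [G, dotProduct_add, dotProduct_sum, Matrix.dotProduct_mulVec]

theorem measurable_knownPart (𝓜 : GaussianModel P T n) (g : Fin n → ℝ) (t : ℕ) :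
    Measurable[𝓜.filtration t] (𝓜.knownPart g t) := by
  refine Finset.measurable_fun_sum _ fun u _ ↦ Measurable.const_add ?_ _
  refine Finset.measurable_fun_sum _ fun j hj ↦ ?_
  exact (continuous_const.dotProduct continuous_id).measurable.comp
    (𝓜.measurable_ε_filtration j (Finset.mem_filter.1 hj).2)

theorem integrable_knownPart (𝓜 : GaussianModel P T n) (g : Fin n → ℝ) (t : ℕ) :
    Integrable (𝓜.knownPart g t) 𝓜.Q :=
  integrable_finsetSum _ fun _ _ ↦ (integrable_const _).add
    (integrable_finsetSum _ fun j _ ↦ 𝓜.integrable_dotProduct_ε j _)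

theorem integrable_dotProduct_G (𝓜 : GaussianModel P T n) (g : Fin n → ℝ) (i : Fin T) :
    Integrable (fun ω ↦ g ⬝ᵥ 𝓜.G i ω) 𝓜.Q := by
  simp_rw [dotProduct_G]
  exact (integrable_const _).add
    (integrable_finsetSum _ fun j _ ↦ 𝓜.integrable_dotProduct_ε j _)

theorem integral_dotProduct_G (𝓜 : GaussianModel P T n) (g : Fin n → ℝ) (i : Fin T) :
    ∫ ω, g ⬝ᵥ 𝓜.G i ω ∂𝓜.Q =
      g ⬝ᵥ 𝓜.A i + ∑ j ∈ Finset.Iic i, Matrix.vecMul g (𝓜.B i j) ⬝ᵥ 𝓜.lam j := by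
  simp_rw [dotProduct_G]
  rw [integral_add (integrable_const _)
    (integrable_finsetSum _ fun j _ ↦ 𝓜.integrable_dotProduct_ε j _),
    integral_finsetSum _ fun j _ ↦ 𝓜.integrable_dotProduct_ε j _]
  simp [integral_dotProduct_ε]

theorem vecMul_S (𝓜 : GaussianModel P T n) (g : Fin n → ℝ) (i : Fin T) (x : Fin n → ℝ) :
    Matrix.vecMul g (𝓜.S i) ⬝ᵥ x = ∑ u ∈ Finset.Ici i, Matrix.vecMul g (𝓜.B u i) ⬝ᵥ x := by
  rw [S, Matrix.vecMul_sum, sum_dotProduct]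

/-- Interchanging the sums over payment times and innovation times collects the coefficients of
each innovation into `S`. -/
theorem sum_integral_dotProduct_G (𝓜 : GaussianModel P T n) (g : Fin n → ℝ) :
    ∑ i, ∫ ω, g ⬝ᵥ 𝓜.G i ω ∂𝓜.Q =
      ∑ i, g ⬝ᵥ 𝓜.A i + ∑ i, g ⬝ᵥ (𝓜.S i).mulVec (𝓜.lam i) := by
  simp_rw [integral_dotProduct_G, Finset.sum_add_distrib, Matrix.dotProduct_mulVec, vecMul_S]
  congr 1
  exact Finset.sum_comm' (by simp)

theorem knownPart_zero (𝓜 : GaussianModel P T n) (g : Fin n → ℝ) (ω : Ω) :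
    𝓜.knownPart g 0 ω = ∑ i, g ⬝ᵥ 𝓜.A i := by
  simp [knownPart]

/-- One period reveals exactly the innovation `gᵀ S_{t+1} ε_{t+1}`. -/
theorem dotProduct_G_add_knownPart_succ (𝓜 : GaussianModel P T n) (g : Fin n → ℝ) (i : Fin T)
    (ω : Ω) :
    g ⬝ᵥ 𝓜.G i ω + 𝓜.knownPart g (i + 1) ω =
      𝓜.knownPart g i ω + Matrix.vecMul g (𝓜.S i) ⬝ᵥ 𝓜.ε i ω := by
  have hIci : Finset.univ.filter (fun u : Fin T ↦ (i : ℕ) ≤ (u : ℕ)) = Finset.Ici i := by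
    ext u; simp only [Finset.mem_filter, Finset.mem_univ, true_and, Finset.mem_Ici, Fin.le_def]
  have hIoi : Finset.univ.filter (fun u : Fin T ↦ (i : ℕ) + 1 ≤ (u : ℕ)) = Finset.Ioi i := by
    ext u
    simp only [Finset.mem_filter, Finset.mem_univ, true_and, Finset.mem_Ioi, Fin.lt_def,
      Nat.succ_le_iff]
  have hiter : ∀ u ∈ Finset.Ici i,
      (Finset.Iic u).filter (fun j : Fin T ↦ (j : ℕ) < (i : ℕ) + 1) =
        insert i ((Finset.Iic u).filter (fun j : Fin T ↦ (j : ℕ) < (i : ℕ))) := by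
    intro u hu
    have hu := Finset.mem_Ici.1 hu
    ext j
    simp only [Finset.mem_filter, Finset.mem_Iic, Finset.mem_insert, Fin.ext_iff, Fin.le_def] at *
    omega
  have hi : (Finset.Iic i).filter (fun j : Fin T ↦ (j : ℕ) < (i : ℕ) + 1) = Finset.Iic i := by
    ext j
    simp only [Finset.mem_filter, Finset.mem_Iic, Fin.le_def]
    omega
  have hleft : g ⬝ᵥ 𝓜.G i ω + 𝓜.knownPart g (i + 1) ω =
      ∑ u ∈ Finset.Ici i, (g ⬝ᵥ 𝓜.A u +
        ∑ j ∈ (Finset.Iic u).filter (fun j : Fin T ↦ (j : ℕ) < (i : ℕ) + 1),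
          Matrix.vecMul g (𝓜.B u j) ⬝ᵥ 𝓜.ε j ω) := by
    rw [← Finset.Ioi_insert, Finset.sum_insert (by simp), hi, knownPart, hIoi, dotProduct_G]
  rw [hleft, knownPart, hIci, vecMul_S, ← Finset.sum_add_distrib]
  refine Finset.sum_congr rfl fun u hu ↦ ?_
  rw [hiter u hu, Finset.sum_insert (by simp)]
  ring

end GaussianModel

namespace GaussianModel

variable {Ω : Type*} [mΩ : MeasurableSpace Ω] {P : Measure Ω} {T n : ℕ}

/-! ### Explicit solution of the backward recursion -/

/-- `σ_t(g)` is the Euclidean norm of `S_tᵀ g`. -/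
theorem sigma_eq (𝓜 : GaussianModel P T n) (g : Fin n → ℝ) (i : Fin T) :
    𝓜.sigma g i = Real.sqrt (Matrix.vecMul g (𝓜.S i) ⬝ᵥ Matrix.vecMul g (𝓜.S i)) := by
  rw [sigma, ← Matrix.mulVec_mulVec, Matrix.dotProduct_mulVec, Matrix.mulVec_transpose]

theorem sigma_nonneg (𝓜 : GaussianModel P T n) (g : Fin n → ℝ) (i : Fin T) : 0 ≤ 𝓜.sigma g i :=
  Real.sqrt_nonneg _

theorem dotProduct_self_vecMul_S (𝓜 : GaussianModel P T n) (g : Fin n → ℝ) (i : Fin T) :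
    Matrix.vecMul g (𝓜.S i) ⬝ᵥ Matrix.vecMul g (𝓜.S i) = 𝓜.sigma g i ^ 2 := by
  rw [sigma_eq, Real.sq_sqrt]
  exact Finset.sum_nonneg fun k _ ↦ mul_self_nonneg _

/-- The expected gain is the `Q`-expectation of `(σ r₀ - gᵀ S ε)_+`. -/
theorem integral_max_eq_expectedGain (𝓜 : GaussianModel P T n) (r₀ : ℝ) (g : Fin n → ℝ)
    (i : Fin T) :
    ∫ ω, max 0 (𝓜.sigma g i * r₀ - Matrix.vecMul g (𝓜.S i) ⬝ᵥ 𝓜.ε i ω) ∂𝓜.Q =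
      𝓜.expectedGain r₀ g i := by
  have hlaw := 𝓜.map_dotProduct_ε_Q i (Matrix.vecMul g (𝓜.S i))
  set b := Matrix.vecMul g (𝓜.S i) ⬝ᵥ 𝓜.lam i with hb
  have hgauss : gaussianReal b (𝓜.sigma g i ^ 2).toNNReal =
      (gaussianReal 0 1).map fun x ↦ b + 𝓜.sigma g i * x := by
    have h1 := gaussianReal_map_const_mul (μ := 0) (v := 1) (𝓜.sigma g i)
    have h2 := gaussianReal_map_const_add (μ := 𝓜.sigma g i * 0)
      (v := NNReal.mk (𝓜.sigma g i ^ 2) (sq_nonneg _) * 1) b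
    rw [← h1, Measure.map_map (by fun_prop) (by fun_prop), mul_zero, zero_add, mul_one] at h2
    rw [Real.toNNReal_of_nonneg (sq_nonneg _)]
    exact h2.symm
  rw [dotProduct_self_vecMul_S, hgauss] at hlaw
  rw [← integral_map (μ := 𝓜.Q) (𝓜.measurable_dotProduct_ε i _).aemeasurable
    (f := fun y : ℝ ↦ max 0 (𝓜.sigma g i * r₀ - y))
    (by fun_prop), hlaw, integral_map (by fun_prop) (by fun_prop), expectedGain]
  refine integral_congr_ae (Filter.Eventually.of_forall fun x ↦ ?_)
  simp only [Matrix.dotProduct_mulVec, ← hb]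
  ring_nf

/-- The deterministic part `∑_{s > t} (σ_s r₀ - c_s)` of the value at time `t`; the index
`i : Fin T` stands for the time `s = i + 1`. -/
noncomputable def deterministicPart (𝓜 : GaussianModel P T n) (r₀ : ℝ) (g : Fin n → ℝ) (t : ℕ) :
    ℝ :=
  ∑ i ∈ Finset.univ.filter (fun i : Fin T ↦ t ≤ (i : ℕ)),
    (𝓜.sigma g i * r₀ - 𝓜.expectedGain r₀ g i)

theorem deterministicPart_eq (𝓜 : GaussianModel P T n) (r₀ : ℝ) (g : Fin n → ℝ) (i : Fin T) :
    𝓜.deterministicPart r₀ g i = 𝓜.sigma g i * r₀ - 𝓜.expectedGain r₀ g i +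
      𝓜.deterministicPart r₀ g (i + 1) := by
  have : Finset.univ.filter (fun u : Fin T ↦ (i : ℕ) ≤ (u : ℕ)) =
      insert i (Finset.univ.filter (fun u : Fin T ↦ (i : ℕ) + 1 ≤ (u : ℕ))) := by
    ext u
    simp only [Finset.mem_filter, Finset.mem_univ, true_and, Finset.mem_insert, Fin.ext_iff]
    omega
  rw [deterministicPart, this, Finset.sum_insert (by simp), deterministicPart]

section Recursion

variable [IsProbabilityMeasure P] (𝓜 : GaussianModel P T n) {M : Measure ℝ}
  (hM : IsMixingDistribution M) (g : Fin n → ℝ)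

include hM in
/-- The capital requirement, given the explicit form of the next value: the known part of
`X_{t+1} + V_{t+1}` plus the risk `σ r₀` of the independent Gaussian increment. -/
theorem R_ae_eq (i : Fin T)
    (hV : 𝓜.V M (fun i ω ↦ g ⬝ᵥ 𝓜.G i ω) (i + 1) =ᵐ[P]
      fun ω ↦ 𝓜.knownPart g (i + 1) ω + 𝓜.deterministicPart (rZero M) g (i + 1)) :
    𝓜.R M (fun i ω ↦ g ⬝ᵥ 𝓜.G i ω) i =ᵐ[P]
      fun ω ↦ 𝓜.knownPart g i ω + 𝓜.deterministicPart (rZero M) g (i + 1) +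
        𝓜.sigma g i * rZero M := by
  rw [R, dif_pos i.isLt, rho]
  have hlaw := 𝓜.map_dotProduct_ε i (Matrix.vecMul g (𝓜.S i))
  rw [dotProduct_self_vecMul_S] at hlaw
  refine condRiskMeasure_ae_eq (𝓜.filtration.le i) hM (𝓜.sigma_nonneg g i)
    ((𝓜.measurable_knownPart g i).add_const _) (𝓜.measurable_dotProduct_ε i _) hlaw ?_ ?_
  · refine indep_of_indep_of_le_right (𝓜.indep_filtration_ε 𝓜.indep_ε i) ?_
    rw [← measurable_iff_comap_le]
    exact (continuous_const.dotProduct continuous_id).measurable.comp (comap_measurable (𝓜.ε i))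
  · filter_upwards [hV] with ω hω
    have := 𝓜.dotProduct_G_add_knownPart_succ g i ω
    simp only [Pi.sub_apply, Pi.neg_apply, hω]
    linarith

include hM in
/-- The known parts cancel in `R_t - X_{t+1} - V_{t+1}`, which is therefore independent of the
past, so that its conditional expectation is a constant. -/
theorem C_ae_eq (i : Fin T)
    (hV : 𝓜.V M (fun i ω ↦ g ⬝ᵥ 𝓜.G i ω) (i + 1) =ᵐ[P]
      fun ω ↦ 𝓜.knownPart g (i + 1) ω + 𝓜.deterministicPart (rZero M) g (i + 1)) :
    𝓜.C M (fun i ω ↦ g ⬝ᵥ 𝓜.G i ω) i =ᵐ[𝓜.Q] fun _ ↦ 𝓜.expectedGain (rZero M) g i := by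
  have hint : (fun ω ↦ max 0 (𝓜.R M (fun i ω ↦ g ⬝ᵥ 𝓜.G i ω) i ω - g ⬝ᵥ 𝓜.G i ω -
      𝓜.V M (fun i ω ↦ g ⬝ᵥ 𝓜.G i ω) (i + 1) ω)) =ᵐ[𝓜.Q]
      fun ω ↦ max 0 (𝓜.sigma g i * rZero M - Matrix.vecMul g (𝓜.S i) ⬝ᵥ 𝓜.ε i ω) := by
    refine 𝓜.Q_absolutelyContinuous.ae_eq ?_
    filter_upwards [hV, 𝓜.R_ae_eq hM g i hV] with ω h1 h2
    have := 𝓜.dotProduct_G_add_knownPart_succ g i ω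
    rw [h1, h2]
    congr 1
    linarith
  refine (condExp_congr_ae hint).trans ?_
  have hmeas : StronglyMeasurable[MeasurableSpace.comap (𝓜.ε i) inferInstance]
      fun ω ↦ max 0 (𝓜.sigma g i * rZero M - Matrix.vecMul g (𝓜.S i) ⬝ᵥ 𝓜.ε i ω) := by
    have hc : Continuous fun x : Fin n → ℝ ↦
        max 0 (𝓜.sigma g i * rZero M - Matrix.vecMul g (𝓜.S i) ⬝ᵥ x) :=
      continuous_const.max (continuous_const.sub (continuous_const.dotProduct continuous_id))
    exact (hc.measurable.comp (comap_measurable (𝓜.ε i))).stronglyMeasurable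
  refine (condExp_indep_eq (𝓜.measurable_ε i).comap_le (𝓜.filtration.le i) hmeas
    (𝓜.indep_filtration_ε 𝓜.iIndepFun_ε_Q i).symm).trans ?_
  rw [𝓜.integral_max_eq_expectedGain]

theorem V_eq_R_sub_C (X : Fin T → Ω → ℝ) (i : Fin T) :
    𝓜.V M X i = 𝓜.R M X i - 𝓜.C M X i := by
  have hneg : -(X i + 𝓜.V M X (i + 1)) = -X i - 𝓜.V M X (i + 1) := neg_add' _ _
  rw [V, dif_pos i.isLt, phi, C, R, dif_pos i.isLt]
  simp only [hneg, Pi.add_apply, sub_sub]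

include hM in
theorem V_ae_eq_aux (k : ℕ) : ∀ t, t + k = T →
    𝓜.V M (fun i ω ↦ g ⬝ᵥ 𝓜.G i ω) t =ᵐ[P]
      fun ω ↦ 𝓜.knownPart g t ω + 𝓜.deterministicPart (rZero M) g t := by
  induction k with
  | zero =>
    intro t ht
    have h : ∀ i : Fin T, ¬ t ≤ (i : ℕ) := fun i ↦ by omega
    rw [V, dif_neg (by omega)]
    refine Filter.Eventually.of_forall fun ω ↦ ?_
    simp [knownPart, deterministicPart, h]
  | succ k ih =>
    intro t ht
    have hV := ih (t + 1) (by omega)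
    obtain ⟨i, rfl⟩ : ∃ i : Fin T, (i : ℕ) = t := ⟨⟨t, by omega⟩, rfl⟩
    rw [V_eq_R_sub_C]
    filter_upwards [𝓜.R_ae_eq hM g i hV, 𝓜.absolutelyContinuous_Q.ae_eq (𝓜.C_ae_eq hM g i hV)]
      with ω h1 h2
    rw [Pi.sub_apply, h1, h2, deterministicPart_eq]
    ring

include hM in
/-- The value of a linear cash flow is its known part plus a deterministic term. -/
theorem V_ae_eq {t : ℕ} (ht : t ≤ T) :
    𝓜.V M (fun i ω ↦ g ⬝ᵥ 𝓜.G i ω) t =ᵐ[P]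
      fun ω ↦ 𝓜.knownPart g t ω + 𝓜.deterministicPart (rZero M) g t :=
  𝓜.V_ae_eq_aux hM g (T - t) t (by omega)

include hM in
theorem C_ae_eq_expectedGain (i : Fin T) :
    𝓜.C M (fun i ω ↦ g ⬝ᵥ 𝓜.G i ω) i =ᵐ[𝓜.Q] fun _ ↦ 𝓜.expectedGain (rZero M) g i :=
  𝓜.C_ae_eq hM g i (𝓜.V_ae_eq hM g i.isLt)

include hM in
theorem isSnellRecursion :
    IsSnellRecursion 𝓜.Q 𝓜.filtration (fun i ω ↦ g ⬝ᵥ 𝓜.G i ω)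
      (𝓜.R M fun i ω ↦ g ⬝ᵥ 𝓜.G i ω) (𝓜.V M fun i ω ↦ g ⬝ᵥ 𝓜.G i ω) := by
  have hR : ∀ t < T, AEStronglyMeasurable[𝓜.filtration t]
      (𝓜.R M (fun i ω ↦ g ⬝ᵥ 𝓜.G i ω) t) 𝓜.Q ∧
      Integrable (𝓜.R M (fun i ω ↦ g ⬝ᵥ 𝓜.G i ω) t) 𝓜.Q := by
    intro t ht
    have h := 𝓜.Q_absolutelyContinuous.ae_eq (𝓜.R_ae_eq hM g ⟨t, ht⟩ (𝓜.V_ae_eq hM g ht))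
    refine ⟨⟨_, (((𝓜.measurable_knownPart g t).add_const _).add_const _).stronglyMeasurable, h⟩,
      Integrable.congr ?_ h.symm⟩
    exact ((𝓜.integrable_knownPart g t).add (integrable_const _)).add (integrable_const _)
  have hV : ∀ t ≤ T, AEStronglyMeasurable[𝓜.filtration t]
      (𝓜.V M (fun i ω ↦ g ⬝ᵥ 𝓜.G i ω) t) 𝓜.Q ∧
      Integrable (𝓜.V M (fun i ω ↦ g ⬝ᵥ 𝓜.G i ω) t) 𝓜.Q := by
    intro t ht
    have h := 𝓜.Q_absolutelyContinuous.ae_eq (𝓜.V_ae_eq hM g ht)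
    refine ⟨⟨_, ((𝓜.measurable_knownPart g t).add_const _).stronglyMeasurable, h⟩,
      Integrable.congr ?_ h.symm⟩
    exact (𝓜.integrable_knownPart g t).add (integrable_const _)
  refine
    { cashflow_meas := fun i ↦ Measurable.aestronglyMeasurable ?_
      cashflow_int := 𝓜.integrable_dotProduct_G g
      capital_meas := fun t ht ↦ (hR t ht).1
      capital_int := fun t ht ↦ (hR t ht).2
      value_meas := fun t ht ↦ (hV t ht).1
      value_int := fun t ht ↦ (hV t ht).2
      capital_terminal := by rw [R, dif_neg (lt_irrefl T)]
      value_terminal := by rw [V, dif_neg (lt_irrefl T)]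
      recursion := fun t ht ↦ ?_ }
  · exact (continuous_const.dotProduct continuous_id).measurable.comp
      (𝓜.measurable_G_filtration i.val.lt_succ_self)
  · set X : Fin T → Ω → ℝ := fun i ω ↦ g ⬝ᵥ 𝓜.G i ω with hX
    have hY : Integrable (fun ω ↦ X ⟨t, ht⟩ ω + 𝓜.V M X (t + 1) ω) 𝓜.Q :=
      (𝓜.integrable_dotProduct_G g _).add (hV (t + 1) ht).2
    have hgain : Integrable
        (fun ω ↦ max 0 (𝓜.R M X t ω - X ⟨t, ht⟩ ω - 𝓜.V M X (t + 1) ω)) 𝓜.Q := by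
      simp_rw [sub_sub]
      exact (integrable_zero _ _ _).sup ((hR t ht).2.sub hY)
    have hmin : (fun ω ↦ min (𝓜.R M X t ω) (X ⟨t, ht⟩ ω + 𝓜.V M X (t + 1) ω)) =
        𝓜.R M X t - fun ω ↦ max 0 (𝓜.R M X t ω - X ⟨t, ht⟩ ω - 𝓜.V M X (t + 1) ω) := by
      ext ω
      rw [Pi.sub_apply, sub_sub]
      rcases le_total (𝓜.R M X t ω) (X ⟨t, ht⟩ ω + 𝓜.V M X (t + 1) ω) with h | h
      · rw [min_eq_left h, max_eq_left (sub_nonpos.2 h), sub_zero]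
      · rw [min_eq_right h, max_eq_right (sub_nonneg.2 h), sub_sub_cancel]
    rw [hmin]
    have hsub := condExp_sub (hR t ht).2 hgain (𝓜.filtration t)
    have hself := condExp_of_aestronglyMeasurable' (𝓜.filtration.le t) (hR t ht).1 (hR t ht).2
    have hVt : 𝓜.V M X t = 𝓜.R M X t - 𝓜.C M X ⟨t, ht⟩ := 𝓜.V_eq_R_sub_C X ⟨t, ht⟩
    rw [hVt]
    filter_upwards [hsub, hself] with ω h1 h2
    rw [h1, Pi.sub_apply, Pi.sub_apply, h2]
    rfl

include hM in
/-- The recursively defined value of a linear cash flow is the value under optimal default. -/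
theorem isResidualLiabilityValue_dotProduct_G :
    𝓜.IsResidualLiabilityValue (fun i ω ↦ g ⬝ᵥ 𝓜.G i ω)
      (𝓜.R M fun i ω ↦ g ⬝ᵥ 𝓜.G i ω) (𝓜.V M fun i ω ↦ g ⬝ᵥ 𝓜.G i ω) := by
  have h := 𝓜.isSnellRecursion hM g
  refine
    { cashflow := fun i ↦ ⟨h.cashflow_meas i, h.cashflow_int i⟩
      capital := fun t ht ↦ ⟨h.capital_meas t ht, h.capital_int t ht⟩
      value := fun t ht ↦ ⟨h.value_meas t ht.le, h.value_int t ht.le⟩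
      terminal := ⟨h.capital_terminal, h.value_terminal⟩
      essInf := fun t ht ↦ ⟨(h.value_int t ht.le).aemeasurable, ?_, ?_⟩ }
  · rintro Y ⟨τ, hτ, hτ', rfl⟩
    exact (h.value_le_condExp_stoppingPayoff (T - t) t (by omega) τ hτ hτ').2
  · intro W _ hW
    obtain ⟨τ, hτ, hτ', heq⟩ := h.exists_condExp_stoppingPayoff_eq (T - t) t (by omega)
    exact (hW _ ⟨τ, hτ, hτ', rfl⟩).trans_eq heq.symm

include hM in
theorem V_zero_ae_eq :
    𝓜.V M (fun i ω ↦ g ⬝ᵥ 𝓜.G i ω) 0 =ᵐ[P]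
      fun _ ↦ ∑ i, ∫ ω, g ⬝ᵥ 𝓜.G i ω ∂𝓜.Q + 𝓜.K (rZero M) g := by
  filter_upwards [𝓜.V_ae_eq hM g (Nat.zero_le T)] with ω hω
  rw [hω, knownPart_zero, sum_integral_dotProduct_G, K, deterministicPart]
  simp only [Nat.zero_le, Finset.filter_true, Finset.sum_sub_distrib]
  ring

end Recursion

/-! ### Replicating portfolios -/

section Replication

variable (𝓜 : GaussianModel P T n) {m : ℕ} (hmn : m + 1 ≤ n)

/-- The residual cash flow of a portfolio is the linear cash flow of its residual weights. -/
theorem Xres_eq (v : Fin m → ℝ) :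
    𝓜.Xres hmn v = fun i ω ↦ residualWeights n v ⬝ᵥ 𝓜.G i ω := by
  ext i ω
  obtain ⟨p, rfl⟩ := Nat.exists_eq_add_of_le hmn
  simp only [Xres, Xo, Xr, Pi.sub_apply, dotProduct, Fin.sum_univ_add, Fin.sum_univ_succ]
  simp only [residualWeights, Fin.val_castAdd, Fin.val_zero, if_true, one_mul, Fin.val_succ,
    Nat.succ_ne_zero, if_false, Nat.add_sub_cancel, Fin.is_lt, dif_pos, Fin.val_natAdd]
  have h : ∀ x : Fin p, ¬ (m + 1 + (x : ℕ) = 0) ∧ ¬ (m + 1 + (x : ℕ) - 1 < m) := fun x ↦ by omega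
  simp only [h, if_false, dif_neg, not_false_iff, zero_mul, Finset.sum_const_zero, add_zero,
    neg_mul, Finset.sum_neg_distrib, sub_eq_add_neg]
  rfl

variable [IsProbabilityMeasure P] {M : Measure ℝ} (hM : IsMixingDistribution M)
include hM

theorem psiMax_eq (v : Fin m → ℝ) :
    𝓜.psiMax hmn M v = ⨆ t, 𝓜.expectedGain (rZero M) (residualWeights n v) t := by
  rw [psiMax, Xres_eq]
  have h := ae_all_iff.2 (𝓜.C_ae_eq_expectedGain hM (residualWeights n v))
  rw [integral_congr_ae (g := fun _ ↦ ⨆ t, 𝓜.expectedGain (rZero M) (residualWeights n v) t)]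
  · simp
  · filter_upwards [h] with ω hω
    simp only [hω]

theorem psiSum_eq (v : Fin m → ℝ) :
    𝓜.psiSum hmn M v = ∑ t, 𝓜.expectedGain (rZero M) (residualWeights n v) t := by
  rw [psiSum, Xres_eq]
  have h := ae_all_iff.2 (𝓜.C_ae_eq_expectedGain hM (residualWeights n v))
  rw [integral_congr_ae (g := fun _ ↦ ∑ t, 𝓜.expectedGain (rZero M) (residualWeights n v) t)]
  · simp
  · filter_upwards [h] with ω hω
    simp only [hω]

/-- The value of the replicating portfolio cancels against its part of the residual value, because
the time-`0` σ-algebra is trivial. -/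
theorem L0_ae_eq (v : Fin m → ℝ) :
    ∀ᵐ ω ∂P, 𝓜.L0 hmn M v ω =
      (∑ i : Fin T, ∫ ω', 𝓜.Xo hmn i ω' ∂𝓜.Q) + 𝓜.K (rZero M) (residualWeights n v) := by
  have hG : ∀ (i : Fin T) (k : Fin n), Integrable (fun ω ↦ 𝓜.G i ω k) 𝓜.Q := by
    intro i k
    simpa using 𝓜.integrable_dotProduct_G (Pi.single k 1) i
  have hXr : ∀ i : Fin T, Integrable (𝓜.Xr hmn v i) 𝓜.Q := fun i ↦
    integrable_finsetSum _ fun k _ ↦ (hG i _).const_mul _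
  have hbot : 𝓜.filtration 0 = ⊥ := by
    simp [filtration]
  have hVX : 𝓜.Xo hmn - 𝓜.Xr hmn v = fun i ω ↦ residualWeights n v ⬝ᵥ 𝓜.G i ω :=
    𝓜.Xres_eq hmn v
  have hsplit : ∀ i : Fin T, ∫ ω, residualWeights n v ⬝ᵥ 𝓜.G i ω ∂𝓜.Q =
      ∫ ω, 𝓜.Xo hmn i ω ∂𝓜.Q - ∫ ω, 𝓜.Xr hmn v i ω ∂𝓜.Q := by
    intro i
    have hXo : Integrable (𝓜.Xo hmn i) 𝓜.Q := hG i _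
    rw [← integral_sub hXo (hXr i)]
    exact integral_congr_ae (Filter.Eventually.of_forall fun ω ↦ (congrFun₂ hVX i ω).symm)
  filter_upwards [𝓜.V_zero_ae_eq hM (residualWeights n v)] with ω hω
  rw [L0, L, hVX, Pi.add_apply, hω, hbot, condExp_bot, integral_finsetSum _ fun i _ ↦ hXr i]
  simp only [hsplit, Nat.zero_le, Finset.filter_true, Finset.sum_sub_distrib]
  ring

end Replication

end GaussianModel

/-! ### Existence of optimal portfolios -/

section Gain

theorem integrable_id_gaussianReal_zero_one : Integrable (fun x : ℝ ↦ x) (gaussianReal 0 1) :=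
  (memLp_id_gaussianReal 1).integrable le_rfl

theorem continuous_integral_max_gaussianReal (r₀ : ℝ) :
    Continuous fun p : ℝ × ℝ ↦ ∫ x, max 0 (p.1 * (r₀ - x) - p.2) ∂(gaussianReal 0 1) := by
  refine continuous_iff_continuousAt.2 fun p ↦ ?_
  refine continuousAt_of_dominated
    (bound := fun x ↦ (|p.1| + 1) * |r₀ - x| + (|p.2| + 1)) ?_ ?_ ?_ ?_
  · exact Filter.Eventually.of_forall fun q ↦ by fun_prop
  · have h1 : ∀ᶠ q : ℝ × ℝ in nhds p, |q.1| < |p.1| + 1 :=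
      (continuous_fst.abs.tendsto p).eventually_lt_const (lt_add_one _)
    have h2 : ∀ᶠ q : ℝ × ℝ in nhds p, |q.2| < |p.2| + 1 :=
      (continuous_snd.abs.tendsto p).eventually_lt_const (lt_add_one _)
    filter_upwards [h1, h2] with q hq1 hq2
    refine Filter.Eventually.of_forall fun x ↦ ?_
    rw [Real.norm_eq_abs, abs_of_nonneg (le_max_left _ _)]
    refine max_le (by positivity) ((le_abs_self _).trans ((abs_sub _ _).trans ?_))
    rw [abs_mul]
    gcongr
  · exact (((integrable_const r₀).sub integrable_id_gaussianReal_zero_one).abs.const_mul _).add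
      (integrable_const _)
  · exact Filter.Eventually.of_forall fun x ↦ by fun_prop

/-- A normal distribution charges every half-line, so the expected positive part of a
nondegenerate normal variable is positive. -/
theorem integral_max_gaussianReal_pos (r₀ b : ℝ) {a : ℝ} (ha : 0 < a) :
    0 < ∫ x, max 0 (a * (r₀ - x) - b) ∂(gaussianReal 0 1) := by
  have hint : Integrable (fun x ↦ max 0 (a * (r₀ - x) - b)) (gaussianReal 0 1) :=
    (integrable_zero _ _ _).sup
      ((((integrable_const r₀).sub integrable_id_gaussianReal_zero_one).const_mul a).sub
        (integrable_const b))
  rw [integral_pos_iff_support_of_nonneg (f := fun x ↦ max 0 (a * (r₀ - x) - b))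
    (fun x ↦ le_max_left _ _) hint]
  have hsub : Set.Iio (r₀ - b / a) ⊆
      Function.support fun x ↦ max 0 (a * (r₀ - x) - b) := by
    intro x hx
    have hx : b / a < r₀ - x := by have := Set.mem_Iio.1 hx; linarith
    rw [div_lt_iff₀' ha] at hx
    exact (lt_max_of_lt_right (sub_pos.2 hx)).ne'
  refine lt_of_lt_of_le (pos_iff_ne_zero.2 fun h ↦ ?_) (measure_mono hsub)
  have := gaussianReal_absolutelyContinuous' 0 one_ne_zero h
  simp at this

end Gain

theorem residualWeights_mem (n : ℕ) {m : ℕ} (v : Fin m → ℝ) :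
    residualWeights n v ∈ admissibleWeights n m := by
  refine fun k ↦ ⟨fun hk ↦ by simp [residualWeights, hk], fun hk ↦ ?_⟩
  have h1 : (k : ℕ) ≠ 0 := by omega
  have h2 : ¬ (k : ℕ) - 1 < m := by omega
  simp [residualWeights, h1, h2]

theorem exists_residualWeights_eq {n m : ℕ} (hmn : m + 1 ≤ n) {g : Fin n → ℝ}
    (hg : g ∈ admissibleWeights n m) : ∃ v : Fin m → ℝ, residualWeights n v = g := by
  refine ⟨fun k ↦ -g ⟨(k : ℕ) + 1, by omega⟩, funext fun k ↦ ?_⟩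
  rw [residualWeights]
  split_ifs with h0 h1
  · exact ((hg k).1 h0).symm
  · rw [neg_neg]
    congr 1
    ext
    exact Nat.sub_add_cancel (Nat.pos_of_ne_zero h0)
  · exact ((hg k).2 (by omega)).symm

theorem continuous_residualWeights (n m : ℕ) :
    Continuous (residualWeights n : (Fin m → ℝ) → Fin n → ℝ) := by
  refine continuous_pi fun k ↦ ?_
  unfold residualWeights
  split_ifs
  · exact continuous_const
  · exact (continuous_apply _).neg
  · exact continuous_const

theorem norm_le_norm_residualWeights {n m : ℕ} (hmn : m + 1 ≤ n) (v : Fin m → ℝ) :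
    ‖v‖ ≤ ‖residualWeights n v‖ := by
  refine (pi_norm_le_iff_of_nonneg (norm_nonneg _)).2 fun k ↦ ?_
  have h := norm_le_pi_norm (residualWeights n v) ⟨(k : ℕ) + 1, by omega⟩
  simpa [residualWeights] using h

/-- Minimization over portfolios is minimization over admissible weights. -/
theorem isMinOn_comp_residualWeights_iff {n m : ℕ} (hmn : m + 1 ≤ n) (F : (Fin n → ℝ) → ℝ)
    (v : Fin m → ℝ) :
    IsMinOn (fun v ↦ F (residualWeights n v)) Set.univ v ↔
      IsMinOn F (admissibleWeights n m) (residualWeights n v) := by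
  simp only [isMinOn_iff, Set.mem_univ, forall_const]
  refine ⟨fun h g hg ↦ ?_, fun h w ↦ h _ (residualWeights_mem n w)⟩
  obtain ⟨w, rfl⟩ := exists_residualWeights_eq hmn hg
  exact h w

/-- A continuous objective that grows at least linearly has a minimizing portfolio. -/
theorem exists_isMinOn_comp_residualWeights {n m : ℕ} (hmn : m + 1 ≤ n)
    {F : (Fin n → ℝ) → ℝ} (hF : Continuous F) {κ : ℝ} (hκ : 0 < κ) (hle : ∀ g, κ * ‖g‖ ≤ F g) :
    ∃ v : Fin m → ℝ, IsMinOn (fun v ↦ F (residualWeights n v)) Set.univ v := by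
  have hcoer : Filter.Tendsto (fun v : Fin m → ℝ ↦ F (residualWeights n v))
      (Filter.cocompact _) Filter.atTop := by
    refine Filter.tendsto_atTop_mono (f := fun v : Fin m → ℝ ↦ κ * ‖v‖) (fun v ↦ ?_)
      (tendsto_norm_cocompact_atTop.const_mul_atTop hκ)
    exact (mul_le_mul_of_nonneg_left (norm_le_norm_residualWeights hmn v) hκ.le).trans (hle _)
  obtain ⟨v, hv⟩ := (hF.comp (continuous_residualWeights n m)).exists_forall_le hcoer
  exact ⟨v, fun w _ ↦ hv w⟩

namespace GaussianModel

variable {Ω : Type*} [mΩ : MeasurableSpace Ω] {P : Measure Ω} {T n : ℕ}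

theorem continuous_expectedGain (𝓜 : GaussianModel P T n) (r₀ : ℝ) (i : Fin T) :
    Continuous fun g ↦ 𝓜.expectedGain r₀ g i := by
  have h1 : Continuous fun g ↦ 𝓜.sigma g i := by
    unfold sigma
    exact (continuous_id.dotProduct (continuous_const.matrix_mulVec continuous_id)).sqrt
  have h2 : Continuous fun g : Fin n → ℝ ↦ g ⬝ᵥ (𝓜.S i).mulVec (𝓜.lam i) :=
    continuous_id.dotProduct continuous_const
  exact (continuous_integral_max_gaussianReal r₀).comp (h1.prodMk h2)

theorem expectedGain_nonneg (𝓜 : GaussianModel P T n) (r₀ : ℝ) (g : Fin n → ℝ) (i : Fin T) :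
    0 ≤ 𝓜.expectedGain r₀ g i :=
  integral_nonneg fun _ ↦ le_max_left _ _

theorem sigma_smul (𝓜 : GaussianModel P T n) {s : ℝ} (hs : 0 ≤ s) (g : Fin n → ℝ) (i : Fin T) :
    𝓜.sigma (s • g) i = s * 𝓜.sigma g i := by
  rw [sigma_eq, sigma_eq, Matrix.smul_vecMul, smul_dotProduct, dotProduct_smul, smul_eq_mul,
    smul_eq_mul, ← mul_assoc, Real.sqrt_mul (mul_self_nonneg s), Real.sqrt_mul_self hs]

theorem expectedGain_smul (𝓜 : GaussianModel P T n) (r₀ : ℝ) {s : ℝ} (hs : 0 ≤ s)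
    (g : Fin n → ℝ) (i : Fin T) :
    𝓜.expectedGain r₀ (s • g) i = s * 𝓜.expectedGain r₀ g i := by
  rw [expectedGain, expectedGain, ← integral_const_mul]
  refine integral_congr_ae (Filter.Eventually.of_forall fun x ↦ ?_)
  simp only [𝓜.sigma_smul hs, smul_dotProduct, smul_eq_mul]
  rw [mul_max_of_nonneg _ _ hs, mul_zero]
  ring_nf

/-- In the last period `S = B_{T,T}` is invertible, so no nonzero linear cash flow is riskless. -/
theorem sigma_last_pos (𝓜 : GaussianModel P T n) {i : Fin T} (hi : (i : ℕ) + 1 = T)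
    {g : Fin n → ℝ} (hg : g ≠ 0) : 0 < 𝓜.sigma g i := by
  have hS : 𝓜.S i = 𝓜.B i i := by
    have : Finset.Ici i = {i} := by
      ext u
      simp only [Finset.mem_Ici, Finset.mem_singleton, Fin.le_def, Fin.ext_iff]
      omega
    rw [S, this, Finset.sum_singleton]
  rw [sigma_eq, Real.sqrt_pos]
  have hne : Matrix.vecMul g (𝓜.S i) ≠ 0 := by
    rw [hS]
    intro h
    exact hg (Matrix.eq_zero_of_vecMul_eq_zero (𝓜.det_B_ne_zero i) h)
  refine lt_of_le_of_ne (Finset.sum_nonneg fun k _ ↦ mul_self_nonneg _) fun h ↦ hne ?_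
  exact dotProduct_self_eq_zero.1 h.symm

/-- The expected gain of the last period grows at least linearly in `g`: it is continuous,
positively homogeneous, and positive on the unit sphere. -/
theorem exists_mul_norm_le_expectedGain_last (𝓜 : GaussianModel P T n) (r₀ : ℝ) {i : Fin T}
    (hi : (i : ℕ) + 1 = T) : ∃ κ : ℝ, 0 < κ ∧ ∀ g, κ * ‖g‖ ≤ 𝓜.expectedGain r₀ g i := by
  rcases (Metric.sphere (0 : Fin n → ℝ) 1).eq_empty_or_nonempty with hempty | hne
  · refine ⟨1, one_pos, fun g ↦ ?_⟩
    have hg : g = 0 := by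
      by_contra hg
      refine (Set.eq_empty_iff_forall_notMem.1 hempty (‖g‖⁻¹ • g)) ?_
      simp [norm_smul, norm_ne_zero_iff.2 hg]
    simpa [hg] using 𝓜.expectedGain_nonneg r₀ 0 i
  · obtain ⟨g₀, hg₀, hmin⟩ := (isCompact_sphere (0 : Fin n → ℝ) 1).exists_isMinOn hne
      (𝓜.continuous_expectedGain r₀ i).continuousOn
    have hg₀ne : g₀ ≠ 0 := by
      rintro rfl
      simp at hg₀
    refine ⟨𝓜.expectedGain r₀ g₀ i,
      integral_max_gaussianReal_pos r₀ _ (𝓜.sigma_last_pos hi hg₀ne), fun g ↦ ?_⟩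
    by_cases hg : g = 0
    · simpa [hg] using 𝓜.expectedGain_nonneg r₀ 0 i
    · have hsph : ‖g‖⁻¹ • g ∈ Metric.sphere (0 : Fin n → ℝ) 1 := by
        simp [norm_smul, norm_ne_zero_iff.2 hg]
      have h := isMinOn_iff.1 hmin _ hsph
      rw [𝓜.expectedGain_smul r₀ (inv_nonneg.2 (norm_nonneg g)),
        inv_mul_eq_div, le_div_iff₀ (norm_pos_iff.2 hg)] at h
      exact h

theorem continuous_iSup_expectedGain (𝓜 : GaussianModel P T n) (r₀ : ℝ) :
    Continuous fun g ↦ ⨆ i, 𝓜.expectedGain r₀ g i := by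
  rcases isEmpty_or_nonempty (Fin T) with h | h
  · simp only [Real.iSup_of_isEmpty]
    exact continuous_const
  · simp_rw [← Finset.sup'_univ_eq_ciSup]
    exact Continuous.finset_sup'_apply _ fun i _ ↦ 𝓜.continuous_expectedGain r₀ i

end GaussianModel

theorem mainTheorem10 {Ω : Type*} [MeasurableSpace Ω] (P : Measure Ω) [IsProbabilityMeasure P]
    {T n m : ℕ} (hT : 1 ≤ T) (hmn : m + 1 ≤ n) (𝓜 : GaussianModel P T n)
    (M : Measure ℝ) (hM : IsMixingDistribution M) :
    -- for every portfolio, the recursive values are the residual liability values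
    (∀ v : Fin m → ℝ, 𝓜.IsResidualLiabilityValue (𝓜.Xres hmn v)
      (𝓜.R M (𝓜.Xres hmn v)) (𝓜.V M (𝓜.Xres hmn v))) ∧
    -- the criterion `E^Q[max_t C_t^v]`
    ((∃ v : Fin m → ℝ, IsMinOn (𝓜.psiMax hmn M) Set.univ v) ∧
      (∀ v : Fin m → ℝ, IsMinOn (𝓜.psiMax hmn M) Set.univ v →
        residualWeights n v ∈ admissibleWeights n m ∧
        IsMinOn (fun g ↦ ⨆ t : Fin T, 𝓜.expectedGain (rZero M) g t)
          (admissibleWeights n m) (residualWeights n v) ∧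
        ∀ᵐ ω ∂P, 𝓜.L0 hmn M v ω =
          (∑ i : Fin T, ∫ ω', 𝓜.Xo hmn i ω' ∂𝓜.Q) + 𝓜.K (rZero M) (residualWeights n v)) ∧
      (∀ g ∈ admissibleWeights n m,
        IsMinOn (fun g ↦ ⨆ t : Fin T, 𝓜.expectedGain (rZero M) g t)
          (admissibleWeights n m) g →
        ∃ v : Fin m → ℝ, residualWeights n v = g ∧ IsMinOn (𝓜.psiMax hmn M) Set.univ v)) ∧
    -- the criterion `E^Q[∑_t C_t^v]`
    ((∃ v : Fin m → ℝ, IsMinOn (𝓜.psiSum hmn M) Set.univ v) ∧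
      (∀ v : Fin m → ℝ, IsMinOn (𝓜.psiSum hmn M) Set.univ v →
        residualWeights n v ∈ admissibleWeights n m ∧
        IsMinOn (fun g ↦ ∑ t : Fin T, 𝓜.expectedGain (rZero M) g t)
          (admissibleWeights n m) (residualWeights n v) ∧
        ∀ᵐ ω ∂P, 𝓜.L0 hmn M v ω =
          (∑ i : Fin T, ∫ ω', 𝓜.Xo hmn i ω' ∂𝓜.Q) + 𝓜.K (rZero M) (residualWeights n v)) ∧
      (∀ g ∈ admissibleWeights n m,
        IsMinOn (fun g ↦ ∑ t : Fin T, 𝓜.expectedGain (rZero M) g t)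
          (admissibleWeights n m) g →
        ∃ v : Fin m → ℝ, residualWeights n v = g ∧ IsMinOn (𝓜.psiSum hmn M) Set.univ v)) := by
  obtain ⟨i, hi⟩ : ∃ i : Fin T, (i : ℕ) + 1 = T := ⟨⟨T - 1, by omega⟩, Nat.sub_add_cancel hT⟩
  obtain ⟨κ, hκ, hle⟩ := 𝓜.exists_mul_norm_le_expectedGain_last (rZero M) hi
  have hmax : 𝓜.psiMax hmn M =
      fun v ↦ ⨆ t, 𝓜.expectedGain (rZero M) (residualWeights n v) t :=
    funext fun v ↦ 𝓜.psiMax_eq hmn hM v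
  have hsum : 𝓜.psiSum hmn M =
      fun v ↦ ∑ t, 𝓜.expectedGain (rZero M) (residualWeights n v) t :=
    funext fun v ↦ 𝓜.psiSum_eq hmn hM v
  rw [hmax, hsum]
  refine ⟨fun v ↦ ?_, ⟨?_, fun v hv ↦ ⟨residualWeights_mem n v, ?_, 𝓜.L0_ae_eq hmn hM v⟩, ?_⟩,
    ⟨?_, fun v hv ↦ ⟨residualWeights_mem n v, ?_, 𝓜.L0_ae_eq hmn hM v⟩, ?_⟩⟩
  · rw [𝓜.Xres_eq hmn v]
    exact 𝓜.isResidualLiabilityValue_dotProduct_G hM (residualWeights n v)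
  · exact exists_isMinOn_comp_residualWeights hmn (𝓜.continuous_iSup_expectedGain (rZero M)) hκ
      fun g ↦ (hle g).trans (le_ciSup (f := fun t ↦ 𝓜.expectedGain (rZero M) g t)
        (Set.finite_range _).bddAbove i)
  · exact (isMinOn_comp_residualWeights_iff hmn
      (fun g ↦ ⨆ t, 𝓜.expectedGain (rZero M) g t) v).1 hv
  · intro g hg hgmin
    obtain ⟨v, rfl⟩ := exists_residualWeights_eq hmn hg
    exact ⟨v, rfl, (isMinOn_comp_residualWeights_iff hmn
      (fun g ↦ ⨆ t, 𝓜.expectedGain (rZero M) g t) v).2 hgmin⟩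
  · exact exists_isMinOn_comp_residualWeights hmn
      (continuous_finsetSum _ fun t _ ↦ 𝓜.continuous_expectedGain (rZero M) t) hκ
      fun g ↦ (hle g).trans (Finset.single_le_sum
        (f := fun t ↦ 𝓜.expectedGain (rZero M) g t)
        (fun t _ ↦ 𝓜.expectedGain_nonneg (rZero M) g t) (Finset.mem_univ i))
  · exact (isMinOn_comp_residualWeights_iff hmn
      (fun g ↦ ∑ t, 𝓜.expectedGain (rZero M) g t) v).1 hv
  · intro g hg hgmin
    obtain ⟨v, rfl⟩ := exists_residualWeights_eq hmn hg
    exact ⟨v, rfl, (isMinOn_comp_residualWeights_iff hmn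
      (fun g ↦ ∑ t, 𝓜.expectedGain (rZero M) g t) v).2 hgmin⟩
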